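/- Let $d\in\mathbf N$ and let $(\Omega,\mathscr B,\mathbf P)$ be a probability space. A tempered generalized stochastic process on $\mathbf R^n$ is a continuous conjugate linear map $u:\mathscr S(\mathbf R^n)\to L^2(\Omega)$, $\varphi\mapsto(u,\varphi)$; its covariance operator $\mathscr K_u:\mathscr S(\mathbf R^n)\to\mathscr S'(\mathbf R^n)$ is given by $(\mathscr K_u\psi,\varphi)=\mathbf E\big((u,\varphi)\overline{(u,\psi)}\big)$ when $u$ has zero mean, where $(f,\varphi)$ denotes the conjugate linear action of $f\in\mathscr S'(\mathbf R^n)$ on $\varphi\in\mathscr S(\mathbf R^n)$. Put $T_af(y)=f(y-a)$ and $M_bf(y)=e^{i\langle y,b\rangle}f(y)$, extended to distributions by $(T_af,\varphi)=(f,T_{-a}\varphi)$ and $(M_bf,\varphi)=(f,M_{-b}\varphi)$. Let $u$ be a zero mean tempered generalized stochastic process on $\mathbf R^d$ which is - Gaussian: for all $\varphi_1,\dots,\varphi_n\in\mathscr S(\mathbf R^d)$ the real and imaginary parts of $(u,\varphi_1),\dots,(u,\varphi_n)$ are jointly Gaussian (possibly degenerate); - symmetric: $\lambda u$ and $u$ have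 the same finite-dimensional distributions for every $\lambda\in\mathbf C$ with $|\lambda|=1$; - stationary: $\mathbf E(u,\varphi)=\int c\,\overline{\varphi(x)}\,\mathrm dx$ for some constant $c\in\mathbf C$, and $\mathbf E\big((u,T_a\varphi)\overline{(u,T_a\psi)}\big)=\mathbf E\big((u,\varphi)\overline{(u,\psi)}\big)$, for all $\varphi,\psi\in C_c^\infty(\mathbf R^d)$ and $a\in\mathbf R^d$. Then there is a unique tempered generalized stochastic process $U=u\otimes\overline u$ on $\mathbf R^{2d}$ with $(U,\varphi\otimes\overline\psi)=(u,\varphi)\overline{(u,\psi)}$ for all $\varphi,\psi\in\mathscr S(\mathbf R^d)$. Let $U_0=U-\mathbf E U$ and let the zero mean Wigner distribution $W_0(u)$ be the tempered generalized stochastic process on $\mathbf R^{2d}$ defined by $$(W_0(u),\Phi)=\big(U_0,(\mathscr F_2^{-1}\Phi)\circ\kappa^{-1}\big),\qquad \Phi\in\mathscr S(\mathbf R^{2d}),$$ where $\mathscr F_2^{-1}\Phi(x,y)=(2\pi)^{-d/2}\int_{\mathbf R^d}\Phi(x,\xi)e^{i\langle y,\xi\rangle}\,\mathrm d\xi$ and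 $\kappa^{-1}(x,y)=\big(\tfrac12(x+y),x-y\big)$. Then $$\mathscr K_{W_0(u)}\,T_{(x,0)}M_{(0,\xi)}=T_{(x,0)}M_{(0,\xi)}\,\mathscr K_{W_0(u)}\qquad\text{for all }x,\xi\in\mathbf R^d,$$ as operators from $\mathscr S(\mathbf R^{2d})$ to $\mathscr S'(\mathbf R^{2d})$. -/

import Mathlib

open SchwartzMap MeasureTheory ProbabilityTheory
open scoped FourierTransform ComplexConjugate

set_option linter.unusedSectionVars false

noncomputable section

namespace StochasticWigner

section PartialFourier

variable {E F G : Type} [NormedAddCommGroup E] [NormedSpace ℝ E]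
  [NormedAddCommGroup F] [InnerProductSpace ℝ F] [FiniteDimensional ℝ F]
  [MeasurableSpace F] [BorelSpace F] [NormedAddCommGroup G] [NormedSpace ℂ G]
  [NormedSpace ℝ G] [IsScalarTower ℝ ℂ G]

/-- The restriction `f(x, ·)` of a Schwartz function of two variables. -/
def slice (f : 𝓢(E × F, G)) (x : E) : 𝓢(F, G) :=
  compCLMOfAntilipschitz ℂ (g := fun y : F => (x, y)) (K := 1)
    (by
      have h : (fun y : F => (x, y)) = fun y => (x, (0 : F)) + ContinuousLinearMap.inr ℝ E F y := by
        ext y <;> simp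
      rw [h]; fun_prop)
    (fun a b => by simp [Prod.edist_eq]) f

theorem slice_apply (f : 𝓢(E × F, G)) (x : E) (y : F) : slice f x y = f (x, y) := rfl

theorem slice_seminorm (f : 𝓢(E × F, G)) (x : E) (j l n : ℕ) :
    ‖x‖ ^ j * SchwartzMap.seminorm ℂ l n (slice f x) ≤ SchwartzMap.seminorm ℂ (j + l) n f := by
  rcases (by positivity : 0 ≤ ‖x‖ ^ j).eq_or_lt with h | h
  · rw [← h, zero_mul]; positivity
  rw [← le_div_iff₀' h]
  refine SchwartzMap.seminorm_le_bound ℂ l n _ (by positivity) fun y => ?_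
  rw [le_div_iff₀' h]
  have h1 : ‖iteratedFDeriv ℝ n (slice f x) y‖ ≤ ‖iteratedFDeriv ℝ n f (x, y)‖ := by
    have e : (slice f x : F → G) =
        (fun z => f ((x, (0 : F)) + z)) ∘ (ContinuousLinearMap.inr ℝ E F) := by
      ext y; simp [slice_apply]
    have hc : ContDiff ℝ n (fun z => f ((x, (0 : F)) + z)) :=
      (f.smooth n).comp (contDiff_const.add contDiff_id)
    rw [e, ContinuousLinearMap.iteratedFDeriv_comp_right _ hc y le_rfl,
      iteratedFDeriv_comp_add_left]
    refine (ContinuousMultilinearMap.norm_compContinuousLinearMap_le _ _).trans ?_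
    have h2 : ‖ContinuousLinearMap.inr ℝ E F‖ ≤ 1 := ContinuousLinearMap.norm_inr_le_one ..
    have h3 : (∏ _i : Fin n, ‖ContinuousLinearMap.inr ℝ E F‖) ≤ 1 :=
      by
      rw [Finset.prod_const]; exact pow_le_one₀ (norm_nonneg (ContinuousLinearMap.inr ℝ E F)) h2
    simpa using mul_le_of_le_one_right (norm_nonneg _) h3
  have hx : ‖x‖ ≤ ‖(x, y)‖ := norm_fst_le (x, y)
  have hy : ‖y‖ ≤ ‖(x, y)‖ := norm_snd_le (x, y)
  calc ‖x‖ ^ j * (‖y‖ ^ l * ‖iteratedFDeriv ℝ n (slice f x) y‖)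
      ≤ ‖(x, y)‖ ^ j * (‖(x, y)‖ ^ l * ‖iteratedFDeriv ℝ n f (x, y)‖) := by gcongr
    _ = ‖(x, y)‖ ^ (j + l) * ‖iteratedFDeriv ℝ n f (x, y)‖ := by ring
    _ ≤ _ := f.le_seminorm ℂ (j + l) n _

/-- The oscillatory integral `∫ exp(i⟨y, ξ⟩) f(x, ξ) dξ` at the point `z = (x, y)`. -/
def partialFourierIntegral (f : 𝓢(E × F, G)) (z : E × F) : G :=
  ∫ ξ, Complex.exp (Complex.I * (inner ℝ z.2 ξ : ℝ)) • f (z.1, ξ)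

theorem partialFourierIntegral_eq {G : Type} [NormedAddCommGroup G] [NormedSpace ℂ G] (f : 𝓢(E × F, G)) (z : E × F) :
    partialFourierIntegral f z = 𝓕⁻ (slice f z.1) ((2 * Real.pi)⁻¹ • z.2) := by
  rw [SchwartzMap.fourierInv_coe, Real.fourierInv_eq']
  refine integral_congr_ae (.of_forall fun ξ => ?_)
  simp only [slice_apply, inner_smul_right]
  rw [real_inner_comm z.2 ξ, mul_inv_cancel_left₀ (by positivity), mul_comm]

theorem partialFourierIntegral_bound0_aux {G : Type} [NormedAddCommGroup G] [NormedSpace ℂ G] (j l : ℕ) : ∃ (s : Finset (ℕ × ℕ)) (C : ℝ), 0 ≤ C ∧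
    ∀ (f : 𝓢(E × F, G)) (z : E × F), ‖z.1‖ ^ j * ‖z.2‖ ^ l * ‖partialFourierIntegral f z‖ ≤
      C * s.sup (schwartzSeminormFamily ℂ (E × F) G) f := by
  let q : Seminorm ℂ 𝓢(F, G) := (SchwartzMap.seminorm ℂ l 0).comp
    (FourierTransform.fourierInvCLM ℂ 𝓢(F, G)).toLinearMap
  have hq : Continuous q :=
    ((schwartz_withSeminorms ℂ F G).continuous_seminorm (l, 0)).comp
      (FourierTransform.fourierInvCLM ℂ 𝓢(F, G)).continuous
  obtain ⟨s, C, -, hs⟩ := Seminorm.bound_of_continuous (schwartz_withSeminorms ℂ F G) q hq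
  refine ⟨s.image fun m => (j + m.1, m.2), (2 * Real.pi) ^ l * (C * s.card), by positivity,
    fun f z => ?_⟩
  have h1 : ‖z.2‖ ^ l * ‖partialFourierIntegral f z‖ ≤ (2 * Real.pi) ^ l * q (slice f z.1) := by
    have := (𝓕⁻ (slice f z.1)).norm_pow_mul_le_seminorm ℂ l ((2 * Real.pi)⁻¹ • z.2)
    rw [← partialFourierIntegral_eq, norm_smul, mul_pow, Real.norm_of_nonneg (by positivity), inv_pow, mul_assoc,
      inv_mul_le_iff₀ (by positivity)] at this
    exact this
  have h2 : q (slice f z.1) ≤ C * ∑ m ∈ s, SchwartzMap.seminorm ℂ m.1 m.2 (slice f z.1) := by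
    refine (hs _).trans ?_
    rw [smul_apply, NNReal.smul_def, smul_eq_mul]
    gcongr
    refine (Seminorm.finset_sup_le_sum _ s _).trans (le_of_eq ?_)
    simp [schwartzSeminormFamily]
  calc ‖z.1‖ ^ j * ‖z.2‖ ^ l * ‖partialFourierIntegral f z‖ = ‖z.1‖ ^ j * (‖z.2‖ ^ l * ‖partialFourierIntegral f z‖) := by ring
    _ ≤ ‖z.1‖ ^ j * ((2 * Real.pi) ^ l *
        (C * ∑ m ∈ s, SchwartzMap.seminorm ℂ m.1 m.2 (slice f z.1))) := by
        refine mul_le_mul_of_nonneg_left (h1.trans ?_) (by positivity)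
        gcongr
    _ = (2 * Real.pi) ^ l *
        (C * ∑ m ∈ s, ‖z.1‖ ^ j * SchwartzMap.seminorm ℂ m.1 m.2 (slice f z.1)) := by
        rw [← Finset.mul_sum]; ring
    _ ≤ (2 * Real.pi) ^ l * (C * ∑ m ∈ s, (s.image fun m => (j + m.1, m.2)).sup
          (schwartzSeminormFamily ℂ (E × F) G) f) := by
        gcongr with m hm
        refine (slice_seminorm f z.1 j m.1 m.2).trans ?_
        exact Seminorm.le_def.1 (Finset.le_sup (f := schwartzSeminormFamily ℂ (E × F) G)
          (Finset.mem_image_of_mem (fun m : ℕ × ℕ => (j + m.1, m.2)) hm)) f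
    _ = _ := by rw [Finset.sum_const, nsmul_eq_mul]; ring


theorem partialFourierIntegral_bound0 (j l : ℕ) : ∃ (s : Finset (ℕ × ℕ)) (C : ℝ), 0 ≤ C ∧
    ∀ (f : 𝓢(E × F, G)) (z : E × F), ‖z.1‖ ^ j * ‖z.2‖ ^ l * ‖partialFourierIntegral f z‖ ≤
      C * s.sup (schwartzSeminormFamily ℂ (E × F) G) f := by
  have h : ‹NormedSpace ℝ G› = NormedSpace.complexToReal := by
    ext r x
    change r • x = (r : ℂ) • x
    rw [← algebraMap_smul ℂ r x]; rfl
  subst h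
  exact partialFourierIntegral_bound0_aux j l

/-- Restriction of a linear map to the first factor (extended by zero). -/
def precompFst : ((E × F) →L[ℝ] G) →L[ℂ] ((E × F) →L[ℝ] G) :=
  LinearMap.mkContinuous (σ := RingHom.id ℂ) (E := (E × F) →L[ℝ] G) (F := (E × F) →L[ℝ] G)
    { toFun := fun A => A.comp ((ContinuousLinearMap.inl ℝ E F).comp (ContinuousLinearMap.fst ℝ E F))
      map_add' := fun A B => by ext <;> simp
      map_smul' := fun c A => by ext <;> simp }
    ‖(ContinuousLinearMap.inl ℝ E F).comp (ContinuousLinearMap.fst ℝ E F)‖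
    (fun A => by rw [mul_comm]; exact ContinuousLinearMap.opNorm_comp_le _ _)

/-- The bilinear form `((x, y), (x', y')) ↦ ⟨y, y'⟩`. -/
def phaseForm : (E × F) →L[ℝ] (E × F) →L[ℝ] ℝ :=
  ((innerSL ℝ).flip : F →L[ℝ] F →L[ℝ] ℝ).bilinearComp
    (ContinuousLinearMap.snd ℝ E F) (ContinuousLinearMap.snd ℝ E F)

/-- The Schwartz function whose partial Fourier integral is the derivative of that of `f`. -/
def partialFourierDeriv : 𝓢(E × F, G) →L[ℂ] 𝓢(E × F, (E × F) →L[ℝ] G) :=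
  (postcompCLM (E := E × F) (precompFst (E := E) (F := F) (G := G))).comp (fderivCLM ℂ (E × F) G)
    + Complex.I • smulRightCLM ℂ G (phaseForm (E := E) (F := F))

theorem partialFourierDeriv_apply (f : 𝓢(E × F, G)) (z w : E × F) :
    partialFourierDeriv f z w = fderiv ℝ f z (w.1, 0) + Complex.I • ((inner ℝ w.2 z.2 : ℝ) • f z) := by
  simp [partialFourierDeriv, precompFst, phaseForm]
  exact congrArg (· • f z) (real_inner_comm w.2 z.2)

theorem bound_slice (f : 𝓢(E × F, G)) : ∃ b : F → ℝ, Integrable b ∧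
    ∀ x ξ, ‖f (x, ξ)‖ ≤ b ξ := by
  set N := Module.finrank ℝ F + 1
  set C := 2 ^ N * (Finset.Iic (N, 0)).sup (fun m => SchwartzMap.seminorm ℝ m.1 m.2) f
  refine ⟨fun ξ => C * (1 + ‖ξ‖) ^ (-(N : ℝ)), (integrable_one_add_norm (by simp [N])).const_mul _,
    fun x ξ => ?_⟩
  have h := SchwartzMap.one_add_le_sup_seminorm_apply (𝕜 := ℝ) (m := (N, 0)) le_rfl le_rfl f (x, ξ)
  rw [norm_iteratedFDeriv_zero] at h
  beta_reduce
  rw [Real.rpow_neg (by positivity), Real.rpow_natCast, ← div_eq_mul_inv,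
    le_div_iff₀ (by positivity), mul_comm]
  refine le_trans ?_ h
  gcongr
  exact norm_snd_le (x, ξ)

theorem norm_expI (t : ℝ) : ‖Complex.exp (Complex.I * t)‖ = 1 := by
  rw [mul_comm]; exact Complex.norm_exp_ofReal_mul_I t

theorem partialFourierIntegral_meas (f : 𝓢(E × F, G)) (z : E × F) : AEStronglyMeasurable
    (fun ξ : F => Complex.exp (Complex.I * (inner ℝ z.2 ξ : ℝ)) • f (z.1, ξ)) := by
  have := f.continuous
  exact Continuous.aestronglyMeasurable (by fun_prop)

theorem partialFourierIntegral_hasFDerivAt (f : 𝓢(E × F, G)) (z : E × F) :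
    HasFDerivAt (partialFourierIntegral f) (partialFourierIntegral (partialFourierDeriv f) z) z := by
  obtain ⟨b, hb, hfb⟩ := bound_slice f
  obtain ⟨b', hb', hfb'⟩ := bound_slice (partialFourierDeriv f)
  refine hasFDerivAt_integral_of_dominated_of_fderiv_le (bound := b')
    (F' := fun z ξ => Complex.exp (Complex.I * (inner ℝ z.2 ξ : ℝ)) • partialFourierDeriv f (z.1, ξ))
    Filter.univ_mem ?_ ?_ ?_ ?_ hb' ?_
  · exact .of_forall fun z => partialFourierIntegral_meas f z
  · refine hb.mono' (partialFourierIntegral_meas f z) (.of_forall fun ξ => ?_)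
    rw [norm_smul, norm_expI, one_mul]; exact hfb _ _
  · exact partialFourierIntegral_meas (partialFourierDeriv f) z
  · refine .of_forall fun ξ z _ => ?_
    rw [norm_smul, norm_expI, one_mul]; exact hfb' _ _
  · refine .of_forall fun ξ z _ => ?_
    have h1 : HasFDerivAt (fun z : E × F => Complex.exp (Complex.I * (inner ℝ z.2 ξ : ℝ)))
        (Complex.exp (Complex.I * (inner ℝ z.2 ξ : ℝ)) • (Complex.I •
          (Complex.ofRealCLM.comp ((innerSL ℝ ξ).comp (ContinuousLinearMap.snd ℝ E F))))) z := by
      have h2 : HasFDerivAt (fun z : E × F => ((inner ℝ z.2 ξ : ℝ) : ℂ))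
          (Complex.ofRealCLM.comp ((innerSL ℝ ξ).comp (ContinuousLinearMap.snd ℝ E F))) z := by
        have := (Complex.ofRealCLM.comp ((innerSL ℝ ξ).comp
          (ContinuousLinearMap.snd ℝ E F))).hasFDerivAt (x := z)
        refine this.congr_of_eventuallyEq (.of_forall fun z => ?_)
        simp [real_inner_comm]
      exact (h2.const_mul Complex.I).cexp
    have h3 : HasFDerivAt (fun z : E × F => f (z.1, ξ))
        ((fderiv ℝ f (z.1, ξ)).comp ((ContinuousLinearMap.inl ℝ E F).comp
          (ContinuousLinearMap.fst ℝ E F))) z := by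
      have h4 : HasFDerivAt (fun z : E × F => (z.1, ξ)) ((ContinuousLinearMap.inl ℝ E F).comp
          (ContinuousLinearMap.fst ℝ E F)) z := by
        have := (hasFDerivAt_fst (𝕜 := ℝ) (p := z)).prodMk (hasFDerivAt_const ξ z)
        exact this
      exact ((f.differentiable (z.1, ξ)).hasFDerivAt).comp z h4
    refine (h1.smul h3).congr_fderiv ?_
    refine ContinuousLinearMap.ext fun w => ?_
    simp [partialFourierDeriv_apply, smul_smul, real_inner_comm]
    module

theorem schwartz_sup_continuous {V H : Type} [NormedAddCommGroup V] [NormedSpace ℝ V]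
    [NormedAddCommGroup H] [NormedSpace ℝ H] [NormedSpace ℂ H] [SMulCommClass ℝ ℂ H]
    (s : Finset (ℕ × ℕ)) : Continuous (s.sup (schwartzSeminormFamily ℂ V H) : Seminorm ℂ 𝓢(V, H)) :=
  Finset.sup_induction (p := fun q : Seminorm ℂ 𝓢(V, H) => Continuous q)
    (by rw [Seminorm.bot_eq_zero]; exact continuous_zero) (fun a ha b hb => ha.sup hb)
    fun i _ => (schwartz_withSeminorms ℂ V H).continuous_seminorm i

theorem partialFourierIntegral_bound (n : ℕ) : ∀ (G : Type) [NormedAddCommGroup G] [NormedSpace ℂ G]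
    [NormedSpace ℝ G] [IsScalarTower ℝ ℂ G] (k : ℕ),
    ∃ (s : Finset (ℕ × ℕ)) (C : ℝ), 0 ≤ C ∧ ∀ (f : 𝓢(E × F, G)) (z : E × F),
      ‖z‖ ^ k * ‖iteratedFDeriv ℝ n (partialFourierIntegral f) z‖ ≤
        C * s.sup (schwartzSeminormFamily ℂ (E × F) G) f := by
  induction n with
  | zero =>
    intro G _ _ _ _ k
    obtain ⟨s, C, hC, h⟩ := partialFourierIntegral_bound0 (E := E) (F := F) (G := G) k 0
    obtain ⟨s', C', hC', h'⟩ := partialFourierIntegral_bound0 (E := E) (F := F) (G := G) 0 k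
    refine ⟨s ∪ s', C + C', by positivity, fun f z => ?_⟩
    rw [norm_iteratedFDeriv_zero, add_mul]
    have e1 : s.sup (schwartzSeminormFamily ℂ (E × F) G) f ≤
        (s ∪ s').sup (schwartzSeminormFamily ℂ (E × F) G) f :=
      Seminorm.le_def.1 (Finset.sup_mono Finset.subset_union_left) f
    have e2 : s'.sup (schwartzSeminormFamily ℂ (E × F) G) f ≤
        (s ∪ s').sup (schwartzSeminormFamily ℂ (E × F) G) f :=
      Seminorm.le_def.1 (Finset.sup_mono Finset.subset_union_right) f
    have a1 := (h f z).trans (mul_le_mul_of_nonneg_left e1 hC)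
    have a2 := (h' f z).trans (mul_le_mul_of_nonneg_left e2 hC')
    have a3 : ‖z‖ ^ k ≤ ‖z.1‖ ^ k + ‖z.2‖ ^ k := by
      rcases max_choice ‖z.1‖ ‖z.2‖ with hm | hm <;> rw [Prod.norm_def, hm]
      · exact le_add_of_nonneg_right (by positivity)
      · exact le_add_of_nonneg_left (by positivity)
    calc ‖z‖ ^ k * ‖partialFourierIntegral f z‖ ≤ (‖z.1‖ ^ k + ‖z.2‖ ^ k) * ‖partialFourierIntegral f z‖ := by gcongr
      _ ≤ _ := by simp only [pow_zero, mul_one, one_mul] at a1 a2; linarith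
  | succ n ih =>
    intro G _ _ _ _ k
    obtain ⟨s, C, hC, h⟩ := ih ((E × F) →L[ℝ] G) k
    let q : Seminorm ℂ 𝓢(E × F, G) :=
      (s.sup (schwartzSeminormFamily ℂ (E × F) ((E × F) →L[ℝ] G))).comp
        (partialFourierDeriv (E := E) (F := F) (G := G)).toLinearMap
    have hq : Continuous q :=
      (schwartz_sup_continuous s).comp
        (partialFourierDeriv (E := E) (F := F) (G := G)).continuous
    obtain ⟨t, D, -, ht⟩ := Seminorm.bound_of_continuous (schwartz_withSeminorms ℂ (E × F) G) q hq
    refine ⟨t, C * D, by positivity, fun f z => ?_⟩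
    have e : fderiv ℝ (partialFourierIntegral f) = partialFourierIntegral (partialFourierDeriv f) := by
      ext1 z; exact (partialFourierIntegral_hasFDerivAt f z).fderiv
    rw [← norm_iteratedFDeriv_fderiv, e, mul_assoc]
    exact (h (partialFourierDeriv f) z).trans (mul_le_mul_of_nonneg_left (ht f) hC)

theorem partialFourierIntegral_contDiff (n : ℕ) : ∀ (G : Type) [NormedAddCommGroup G] [NormedSpace ℂ G]
    [NormedSpace ℝ G] [IsScalarTower ℝ ℂ G]
    (f : 𝓢(E × F, G)), ContDiff ℝ n (partialFourierIntegral f) := by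
  induction n with
  | zero =>
    intro G _ _ _ _ f
    exact contDiff_zero.2 (continuous_iff_continuousAt.2 fun z => (partialFourierIntegral_hasFDerivAt f z).continuousAt)
  | succ n ih =>
    intro G _ _ _ _ f
    have e : fderiv ℝ (partialFourierIntegral f) = partialFourierIntegral (partialFourierDeriv f) := by
      ext1 z; exact (partialFourierIntegral_hasFDerivAt f z).fderiv
    rw [Nat.cast_succ]
    refine contDiff_succ_iff_fderiv.2 ⟨fun z => (partialFourierIntegral_hasFDerivAt f z).differentiableAt,
      fun h => absurd h (WithTop.coe_ne_top (a := (n : ℕ∞))), ?_⟩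
    rw [e]; exact ih _ _

theorem partialFourierIntegral_add (f g : 𝓢(E × F, G)) (z : E × F) : partialFourierIntegral (f + g) z = partialFourierIntegral f z + partialFourierIntegral g z := by
  have hi (f : 𝓢(E × F, G)) : Integrable
      (fun ξ : F => Complex.exp (Complex.I * (inner ℝ z.2 ξ : ℝ)) • f (z.1, ξ)) := by
    obtain ⟨b, hb, hfb⟩ := bound_slice f
    refine hb.mono' (partialFourierIntegral_meas f z) (.of_forall fun ξ => ?_)
    rw [norm_smul, norm_expI, one_mul]; exact hfb _ _
  rw [partialFourierIntegral, partialFourierIntegral, partialFourierIntegral, ← integral_add (hi f) (hi g)]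
  simp

theorem partialFourierIntegral_smul (c : ℂ) (f : 𝓢(E × F, G)) (z : E × F) : partialFourierIntegral (c • f) z = c • partialFourierIntegral f z := by
  rw [partialFourierIntegral, partialFourierIntegral, ← integral_smul]
  refine integral_congr_ae (.of_forall fun ξ => ?_)
  simp [smul_smul, mul_comm]

/-- The inverse partial Fourier transform in the second variable,
`(𝓕₂⁻¹ f)(x, y) = (2π)^(-dim F / 2) ∫ exp(i⟨y, ξ⟩) f(x, ξ) dξ`, as a continuous operator on the
Schwartz space. -/
def partialFourierInv : 𝓢(E × F, ℂ) →L[ℂ] 𝓢(E × F, ℂ) :=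
  (((2 * Real.pi) ^ (-(Module.finrank ℝ F : ℝ) / 2) : ℝ) : ℂ) •
    SchwartzMap.mkCLM (σ := RingHom.id ℂ) (fun f => partialFourierIntegral f) partialFourierIntegral_add partialFourierIntegral_smul
      (fun f => contDiff_infty.2 fun n => partialFourierIntegral_contDiff n ℂ f) (fun m => partialFourierIntegral_bound m.2 ℂ m.1)

theorem partialFourierInv_apply (f : 𝓢(E × F, ℂ)) (z : E × F) : partialFourierInv f z =
    (((2 * Real.pi) ^ (-(Module.finrank ℝ F : ℝ) / 2) : ℝ) : ℂ) *
    ∫ ξ, Complex.exp (Complex.I * (inner ℝ z.2 ξ : ℝ)) * f (z.1, ξ) := rfl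

end PartialFourier

section Tensor

variable {V W : Type} [NormedAddCommGroup V] [NormedSpace ℝ V] [NormedAddCommGroup W]
  [NormedSpace ℝ W]

theorem norm_iteratedFDeriv_comp_le_of_norm_le_one (L : V →L[ℝ] W) (hL : ‖L‖ ≤ 1) (g : 𝓢(W, ℂ)) (z : V) (i : ℕ) :
    ‖iteratedFDeriv ℝ i (fun z => g (L z)) z‖ ≤ ‖iteratedFDeriv ℝ i g (L z)‖ := by
  have := L.iteratedFDeriv_comp_right (g.smooth i) z le_rfl
  rw [show (fun z => g (L z)) = g ∘ L from rfl, this]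
  refine (ContinuousMultilinearMap.norm_compContinuousLinearMap_le _ _).trans ?_
  have h3 : (∏ _i : Fin i, ‖L‖) ≤ 1 := by
    rw [Finset.prod_const]; exact pow_le_one₀ (norm_nonneg L) hL
  simpa using mul_le_of_le_one_right (norm_nonneg _) h3

theorem norm_pow_le_add (z : V × W) (k : ℕ) : ‖z‖ ^ k ≤ ‖z.1‖ ^ k + ‖z.2‖ ^ k := by
  rcases max_choice ‖z.1‖ ‖z.2‖ with hm | hm <;> rw [Prod.norm_def, hm]
  · exact le_add_of_nonneg_right (by positivity)
  · exact le_add_of_nonneg_left (by positivity)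

/-- The tensor product `(f ⊗ g)(x, y) = f(x) g(y)` of Schwartz functions. -/
def tensor (f : 𝓢(V, ℂ)) (g : 𝓢(W, ℂ)) : 𝓢(V × W, ℂ) where
  toFun z := f z.1 * g z.2
  smooth' := ((f.smooth _).comp contDiff_fst).mul ((g.smooth _).comp contDiff_snd)
  decay' := by
    intro k n
    refine ⟨∑ i ∈ Finset.range (n + 1), (n.choose i : ℝ) *
      (SchwartzMap.seminorm ℝ k i f * SchwartzMap.seminorm ℝ 0 (n - i) g +
        SchwartzMap.seminorm ℝ 0 i f * SchwartzMap.seminorm ℝ k (n - i) g), fun z => ?_⟩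
    have h := norm_iteratedFDeriv_mul_le (𝕜 := ℝ) (N := n)
      (f := fun z : V × W => f z.1) (g := fun z : V × W => g z.2)
      ((f.smooth n).comp contDiff_fst) ((g.smooth n).comp contDiff_snd) z le_rfl
    refine (mul_le_mul_of_nonneg_left h (by positivity)).trans ?_
    rw [Finset.mul_sum]
    refine Finset.sum_le_sum fun i _ => ?_
    have h1 : ‖iteratedFDeriv ℝ i (fun z : V × W => f z.1) z‖ ≤ ‖iteratedFDeriv ℝ i f z.1‖ :=
      norm_iteratedFDeriv_comp_le_of_norm_le_one (ContinuousLinearMap.fst ℝ V W)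
        (ContinuousLinearMap.norm_fst_le ..) f z i
    have h2 : ‖iteratedFDeriv ℝ (n - i) (fun z : V × W => g z.2) z‖ ≤
        ‖iteratedFDeriv ℝ (n - i) g z.2‖ :=
      norm_iteratedFDeriv_comp_le_of_norm_le_one (ContinuousLinearMap.snd ℝ V W)
        (ContinuousLinearMap.norm_snd_le ..) g z (n - i)
    have f1 := f.le_seminorm ℝ k i z.1
    have f0 := f.norm_iteratedFDeriv_le_seminorm ℝ i z.1
    have g1 := g.le_seminorm ℝ k (n - i) z.2
    have g0 := g.norm_iteratedFDeriv_le_seminorm ℝ (n - i) z.2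
    calc ‖z‖ ^ k * ((n.choose i : ℝ) * ‖iteratedFDeriv ℝ i (fun z : V × W => f z.1) z‖ *
          ‖iteratedFDeriv ℝ (n - i) (fun z : V × W => g z.2) z‖)
        ≤ (‖z.1‖ ^ k + ‖z.2‖ ^ k) * ((n.choose i : ℝ) * ‖iteratedFDeriv ℝ i f z.1‖ *
          ‖iteratedFDeriv ℝ (n - i) g z.2‖) := by
          gcongr; exact norm_pow_le_add z k
      _ = (n.choose i : ℝ) * ((‖z.1‖ ^ k * ‖iteratedFDeriv ℝ i f z.1‖) *
          ‖iteratedFDeriv ℝ (n - i) g z.2‖ + ‖iteratedFDeriv ℝ i f z.1‖ *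
          (‖z.2‖ ^ k * ‖iteratedFDeriv ℝ (n - i) g z.2‖)) := by ring
      _ ≤ _ := by gcongr

theorem tensor_apply (f : 𝓢(V, ℂ)) (g : 𝓢(W, ℂ)) (z : V × W) : tensor f g z = f z.1 * g z.2 := rfl

/-- The complex conjugate of a Schwartz function. -/
def conjSchwartz (g : 𝓢(V, ℂ)) : 𝓢(V, ℂ) :=
  postcompCLM (𝕜 := ℝ) (Complex.conjCLE : ℂ →L[ℝ] ℂ) g

theorem conjSchwartz_apply (g : 𝓢(V, ℂ)) (x : V) : conjSchwartz g x = conj (g x) := rfl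

end Tensor

section Processes

variable {V : Type} [NormedAddCommGroup V] [NormedSpace ℝ V]
  {Ω : Type*} [MeasurableSpace Ω]

/-- Tempered generalized stochastic processes on `V`: continuous conjugate linear maps from the
Schwartz space to `L²(Ω)`. The random variable `(u, φ)` is `u φ`. -/
abbrev TemperedGSP (V : Type) [NormedAddCommGroup V] [NormedSpace ℝ V]
    {Ω : Type*} [MeasurableSpace Ω] (P : Measure Ω) :=
  𝓢(V, ℂ) →L⋆[ℂ] Lp ℂ 2 P

/-- Tempered distributions in the conjugate linear convention: continuous conjugate linear
functionals `φ ↦ (f, φ)` on the Schwartz space. -/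
abbrev AntiDistribution (V : Type) [NormedAddCommGroup V] [NormedSpace ℝ V] :=
  𝓢(V, ℂ) →L⋆[ℂ] ℂ

/-- The process takes values in `L²₀(Ω)`, that is `E (u, φ) = 0` for all `φ`. -/
def IsZeroMean {P : Measure Ω} (u : TemperedGSP V P) : Prop :=
  ∀ φ : 𝓢(V, ℂ), ∫ ω, u φ ω ∂P = 0

/-- For every finite family `φ₁, …, φₙ` the real random vector formed by the real parts and the
imaginary parts of `(u, φ₁), …, (u, φₙ)` is Gaussian (possibly degenerate). -/
def IsGaussianGSP {P : Measure Ω} (u : TemperedGSP V P) : Prop :=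
  ∀ (n : ℕ) (φ : Fin n → 𝓢(V, ℂ)),
    HasGaussianLaw (fun ω => (Sum.elim (fun i => (u (φ i) ω).re) (fun i => (u (φ i) ω).im) :
      Fin n ⊕ Fin n → ℝ)) P

/-- For every complex number `c` of modulus one, `c u` and `u` have the same law, that is, the same
finite-dimensional distributions. -/
def IsSymmetricGSP {P : Measure Ω} (u : TemperedGSP V P) : Prop :=
  ∀ c : ℂ, ‖c‖ = 1 → ∀ (n : ℕ) (φ : Fin n → 𝓢(V, ℂ)),
    IdentDistrib (fun ω i => c * u (φ i) ω) (fun ω i => u (φ i) ω) P P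

/-- The translation operator `(T_a f)(x) = f(x - a)` on Schwartz functions. -/
def translation (a : V) : 𝓢(V, ℂ) →L[ℂ] 𝓢(V, ℂ) :=
  compSubConstCLM ℂ a

theorem translation_apply (a : V) (f : 𝓢(V, ℂ)) (x : V) : translation a f x = f (x - a) := rfl

/-- Translation of a distribution, `(T_a f, φ) = (f, T_{-a} φ)`. -/
def translationDist (a : V) (f : AntiDistribution V) : AntiDistribution V :=
  f.comp (translation (-a))

/-- Stationarity: the mean is a constant `c`, that is `E (u, φ) = ∫ c conj(φ(x)) dx`, and the
covariance `(k_u, φ ⊗ conj ψ) = E ((u, φ) conj (u, ψ))` is invariant under simultaneous translation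
of the test functions `φ, ψ ∈ C_c^∞`. -/
def IsStationaryGSP [MeasureSpace V] {P : Measure Ω} (u : TemperedGSP V P) : Prop :=
  (∃ c : ℂ, ∀ φ : 𝓢(V, ℂ), HasCompactSupport φ → ∫ ω, u φ ω ∂P = ∫ x, c * conj (φ x)) ∧
  ∀ φ ψ : 𝓢(V, ℂ), HasCompactSupport φ → HasCompactSupport ψ → ∀ a : V,
    ∫ ω, u (translation a φ) ω * conj (u (translation a ψ) ω) ∂P = ∫ ω, u φ ω * conj (u ψ ω) ∂P

/-- The covariance operator `K_u : 𝓢 → 𝓢'` of a process,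
`(K_u ψ, φ) = E ((u, φ) conj (u, ψ))`. -/
def gspCovariance {P : Measure Ω} (u : TemperedGSP V P) : 𝓢(V, ℂ) →ₗ[ℂ] AntiDistribution V where
  toFun ψ := (innerSL ℂ (u ψ)).comp u
  map_add' ψ₁ ψ₂ := by ext φ; simp
  map_smul' c ψ := by ext φ; simp

theorem gspCovariance_apply {P : Measure Ω} (u : TemperedGSP V P) (ψ φ : 𝓢(V, ℂ)) :
    gspCovariance u ψ φ = ∫ ω, u φ ω * conj (u ψ ω) ∂P := by
  change inner ℂ (u ψ) (u φ) = _
  rw [L2.inner_def]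
  rfl

/-- The centered process `u - E u`, that is `(u - E u, φ) = (u, φ) - E (u, φ)`. The expectation of
an element of `L²(Ω)` is its inner product with the constant one. -/
def centeredGSP {P : Measure Ω} [IsProbabilityMeasure P] (u : TemperedGSP V P) : TemperedGSP V P :=
  u - ((Lp.constL 2 P ℂ).comp (innerSL ℂ (Lp.const 2 P (1 : ℂ)))).comp u

theorem centeredGSP_apply {P : Measure Ω} [IsProbabilityMeasure P] (u : TemperedGSP V P)
    (φ : 𝓢(V, ℂ)) : centeredGSP u φ =ᵐ[P] fun ω => u φ ω - ∫ ω', u φ ω' ∂P := by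
  have h : inner ℂ (Lp.const 2 P (1 : ℂ)) (u φ) = ∫ ω', u φ ω' ∂P := by
    rw [L2.inner_def]
    refine integral_congr_ae ?_
    filter_upwards [Lp.coeFn_const (p := 2) (μ := P) (1 : ℂ)] with ω hω
    simp [hω]
  have e : centeredGSP u φ = u φ - Lp.const 2 P (∫ ω', u φ ω' ∂P) := by rw [← h]; rfl
  rw [e]
  filter_upwards [Lp.coeFn_sub (u φ) (Lp.const 2 P (∫ ω', u φ ω' ∂P)),
    Lp.coeFn_const (p := 2) (μ := P) (∫ ω', u φ ω' ∂P)] with ω h1 h2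
  rw [h1, Pi.sub_apply, h2]
  rfl

/-- `U` is a continuous extension to `𝓢(V × V)` of the sesquilinear form
`(u ⊗ conj u, φ ⊗ conj ψ) = (u, φ) conj (u, ψ)`. -/
def IsTensorSquare {P : Measure Ω} (u : TemperedGSP V P) (U : TemperedGSP (V × V) P) : Prop :=
  ∀ φ ψ : 𝓢(V, ℂ), U (tensor φ (conjSchwartz ψ)) =ᵐ[P] fun ω => u φ ω * conj (u ψ ω)

end Processes

section PhaseSpace

variable {d : ℕ} {Ω : Type*} [MeasurableSpace Ω]

/-- The phase space `T^*ℝ^d = ℝ^d × ℝ^d`. -/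
abbrev PhaseSpace (d : ℕ) := EuclideanSpace ℝ (Fin d) × EuclideanSpace ℝ (Fin d)

/-- The invertible linear map `κ(x, y) = (x + y / 2, x - y / 2)`, with inverse
`κ⁻¹(x, y) = ((x + y) / 2, x - y)`. -/
def kappa (d : ℕ) : PhaseSpace d ≃L[ℝ] PhaseSpace d where
  toFun z := (z.1 + (2⁻¹ : ℝ) • z.2, z.1 - (2⁻¹ : ℝ) • z.2)
  invFun z := ((2⁻¹ : ℝ) • (z.1 + z.2), z.1 - z.2)
  map_add' z w := by
    ext1
    · simp only [Prod.fst_add, Prod.snd_add]; module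
    · simp only [Prod.fst_add, Prod.snd_add]; module
  map_smul' c z := by
    ext1
    · simp only [Prod.smul_fst, Prod.smul_snd, RingHom.id_apply]; module
    · simp only [Prod.smul_fst, Prod.smul_snd, RingHom.id_apply]; module
  left_inv z := by
    ext1
    · dsimp only; module
    · dsimp only; module
  right_inv z := by
    ext1
    · dsimp only; module
    · dsimp only; module
  continuous_toFun := by fun_prop
  continuous_invFun := by fun_prop

theorem hasTemperateGrowth_expI :
    Function.HasTemperateGrowth (fun t : ℝ => Complex.exp (Complex.I * t)) := by
  have h (n : ℕ) : iteratedDeriv n (fun t : ℝ => Complex.exp (Complex.I * t)) =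
      fun t : ℝ => Complex.I ^ n * Complex.exp (Complex.I * t) := by
    induction n with
    | zero => simp
    | succ n ih =>
      rw [iteratedDeriv_succ, ih]
      ext t
      have h1 : HasDerivAt (fun t : ℝ => Complex.I * (t : ℂ)) Complex.I t := by
        simpa using (Complex.ofRealCLM.hasDerivAt (x := t)).const_mul Complex.I
      rw [(h1.cexp.const_mul (Complex.I ^ n)).deriv]
      ring
  refine ⟨(contDiff_const.mul Complex.ofRealCLM.contDiff).cexp, fun n => ⟨0, 1, fun t => ?_⟩⟩
  rw [norm_iteratedFDeriv_eq_norm_iteratedDeriv, h n]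
  simp

/-- The modulation operator on the phase space,
`(M_b f)(x, ξ) = exp(i(⟨x, b₁⟩ + ⟨ξ, b₂⟩)) f(x, ξ)` for `b = (b₁, b₂)`. -/
def modulation (b : PhaseSpace d) : 𝓢(PhaseSpace d, ℂ) →L[ℂ] 𝓢(PhaseSpace d, ℂ) :=
  smulLeftCLM ℂ fun z => Complex.exp (Complex.I * (inner ℝ z.1 b.1 + inner ℝ z.2 b.2 : ℝ))

theorem modulation_apply (b : PhaseSpace d) (f : 𝓢(PhaseSpace d, ℂ)) (z : PhaseSpace d) :
    modulation b f z =
      Complex.exp (Complex.I * (inner ℝ z.1 b.1 + inner ℝ z.2 b.2 : ℝ)) * f z := by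
  have h : Function.HasTemperateGrowth (fun z : PhaseSpace d =>
      Complex.exp (Complex.I * (inner ℝ z.1 b.1 + inner ℝ z.2 b.2 : ℝ))) := by
    have h1 : Function.HasTemperateGrowth
        (fun z : PhaseSpace d => (inner ℝ z.1 b.1 + inner ℝ z.2 b.2 : ℝ)) := by
      convert (((innerSL ℝ b.1).comp (ContinuousLinearMap.fst ℝ _ _) +
        (innerSL ℝ b.2).comp (ContinuousLinearMap.snd ℝ _ _) :
          PhaseSpace d →L[ℝ] ℝ)).hasTemperateGrowth using 1
      ext z
      simp [real_inner_comm]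
    exact hasTemperateGrowth_expI.comp h1
  exact smulLeftCLM_apply_apply h f z

/-- Modulation of a distribution, `(M_b f, φ) = (f, M_{-b} φ)`. -/
def modulationDist (b : PhaseSpace d) (f : AntiDistribution (PhaseSpace d)) :
    AntiDistribution (PhaseSpace d) :=
  f.comp (modulation (-b))

/-- The Wigner distribution in terms of `U = u ⊗ conj u`: for `Φ ∈ 𝓢(ℝ^{2d})`,
`(W(u), Φ) = (U, (𝓕₂⁻¹ Φ) ∘ κ⁻¹)`. -/
def wigner {P : Measure Ω} (U : TemperedGSP (PhaseSpace d) P) : TemperedGSP (PhaseSpace d) P :=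
  U.comp ((compCLMOfContinuousLinearEquiv ℂ (kappa d).symm).comp partialFourierInv)

/-- The zero mean Wigner distribution in terms of `U = u ⊗ conj u`: with `U₀ = U - E U`,
`(W₀(u), Φ) = (U₀, (𝓕₂⁻¹ Φ) ∘ κ⁻¹)`. -/
def zeroMeanWigner {P : Measure Ω} [IsProbabilityMeasure P] (U : TemperedGSP (PhaseSpace d) P) :
    TemperedGSP (PhaseSpace d) P :=
  wigner (centeredGSP U)

end PhaseSpace

end StochasticWigner

end

open StochasticWigner

/-! Write K(φ, ψ) = E (u, φ) conj (u, ψ). For a zero mean Gaussian process the fourth moment of (u,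
φ), conj (u, ψ), conj (u, φ'), (u, ψ') is the sum over three pairings (Isserlis, Wick). Centering
`U` removes the pairing inside each of the two products, and symmetry removes the pairing of (u, φ)
with (u, ψ'), because E (u, φ)(u, ψ') = 0. What remains is the product K(φ, φ') K(ψ', ψ), so the
covariance of U₀ splits into a factor in the first variables and a factor in the second
(`inner_centeredGSP_tensor`). Stationarity makes K invariant under a common translation of its
arguments; hence the covariance of U₀ is invariant under independent translations in the two
variables, that is, under all translations of ℝ^{2d} (`inner_centeredGSP_translation`). The map Φ ↦
(𝓕₂⁻¹Φ) ∘ κ⁻¹ turns the shift T_{(x,0)} M_{(0,ξ)} into translation by κ(x, -ξ), so the covariance of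
W₀(u) is invariant under these shifts. Since they are invertible and act on distributions through
their inverses, invariance is the same as commutation.

The existence of `U` is a kernel theorem with values in a Banach space. Wick's formula bounds the L²
norm of (u, φ) conj (u, ψ) by 2 ‖(u, φ)‖ ‖(u, ψ)‖, which makes the product a bounded form
(`norm_productForm_le`). To extend it, a Schwartz function on V × W is expanded in the first
variable as an integral of time-frequency shifts of a window, Φ = ∫ atom(w) ⊗ c(w) dw, where the
coefficients c(w) are Schwartz functions on W that decay rapidly in w while the atoms grow only
polynomially (`eq_integral_atom_mul`, `exists_atom_mul_slice_le`). The extension is U Φ = ∫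
b(atom(w), c(w)) dw (`exists_kernel`).

The same expansion supplies the density statements: tensor products span a dense subspace, which
gives uniqueness of `U`, and compactly supported functions are dense, which carries stationarity
from C_c^∞ to 𝓢. All of this rests on continuous linear maps commuting with integrals of Schwartz
functions (`map_integral_schwartz`). -/

namespace StochasticWigner

/-! ### Integrals of Schwartz-valued families and continuous linear maps -/

section IntegralCommute

variable {E G H A : Type} [NormedAddCommGroup E] [NormedSpace ℝ E]
  [NormedAddCommGroup G] [NormedSpace ℝ G]

/-- The values of the `n`-th derivative, with only the normed space structure retained. -/
def DerivSpace (E G : Type) [NormedAddCommGroup E] [NormedSpace ℝ E]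
    [NormedAddCommGroup G] [NormedSpace ℝ G] (n : ℕ) : Type := E [×n]→L[ℝ] G

noncomputable instance (n : ℕ) : NormedAddCommGroup (DerivSpace E G n) :=
  inferInstanceAs (NormedAddCommGroup (E [×n]→L[ℝ] G))

noncomputable instance (n : ℕ) : NormedSpace ℝ (DerivSpace E G n) :=
  inferInstanceAs (NormedSpace ℝ (E [×n]→L[ℝ] G))

instance (n : ℕ) [CompleteSpace G] : CompleteSpace (DerivSpace E G n) :=
  inferInstanceAs (CompleteSpace (E [×n]→L[ℝ] G))

/-- The `n`-th derivative of a Schwartz function. -/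
noncomputable def nthDeriv (n : ℕ) (f : 𝓢(E, G)) (x : E) : DerivSpace E G n :=
  iteratedFDeriv ℝ n f x

theorem norm_nthDeriv (n : ℕ) (f : 𝓢(E, G)) (x : E) :
    ‖nthDeriv n f x‖ = ‖iteratedFDeriv ℝ n f x‖ := rfl

/-- The bounded continuous function `x ↦ ‖x‖ ^ k • Dⁿ f(x)`. -/
noncomputable def weightedDerivFun (k n : ℕ) (f : 𝓢(E, G)) :
    BoundedContinuousFunction E (DerivSpace E G n) :=
  BoundedContinuousFunction.ofNormedAddCommGroup
    (fun x => ‖x‖ ^ k • nthDeriv n f x)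
    ((continuous_norm.pow k).smul
      (show Continuous (nthDeriv n f) from (f.smooth n).continuous_iteratedFDeriv le_rfl))
    (SchwartzMap.seminorm ℝ k n f)
    (fun x => by rw [norm_smul, norm_pow, norm_norm, norm_nthDeriv]; exact f.le_seminorm ℝ k n x)

theorem weightedDerivFun_apply (k n : ℕ) (f : 𝓢(E, G)) (x : E) :
    weightedDerivFun k n f x = ‖x‖ ^ k • nthDeriv n f x := rfl

/-- The weighted derivative `x ↦ ‖x‖ ^ k • Dⁿ f(x)` as an operator from the Schwartz space to the
bounded continuous functions. -/
noncomputable def weightedDeriv (k n : ℕ) :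
    𝓢(E, G) →L[ℝ] BoundedContinuousFunction E (DerivSpace E G n) :=
  mkCLMtoNormedSpace (σ := RingHom.id ℝ) (E := G) (D := E)
    (G := BoundedContinuousFunction E (DerivSpace E G n))
    (weightedDerivFun k n)
    (fun f g => by
      ext1 x
      have : nthDeriv n (f + g) x = nthDeriv n f x + nthDeriv n g x :=
        iteratedFDeriv_add_apply (f.smooth n).contDiffAt (g.smooth n).contDiffAt (x := x)
      rw [BoundedContinuousFunction.add_apply, weightedDerivFun_apply, weightedDerivFun_apply,
        weightedDerivFun_apply, ← smul_add, ← this])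
    (fun c f => by
      ext1 x
      have : nthDeriv n (c • f) x = c • nthDeriv n f x :=
        iteratedFDeriv_const_smul_apply (a := c) (f.smooth n).contDiffAt (x := x)
      rw [BoundedContinuousFunction.smul_apply, weightedDerivFun_apply, weightedDerivFun_apply,
        RingHom.id_apply, smul_comm c, ← this])
    ⟨{(k, n)}, 1, zero_le_one, fun f => by
      rw [Finset.sup_singleton, one_mul]
      exact BoundedContinuousFunction.norm_ofNormedAddCommGroup_le _ (apply_nonneg _ _) _⟩

theorem weightedDeriv_apply (k n : ℕ) (f : 𝓢(E, G)) (x : E) :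
    weightedDeriv k n f x = ‖x‖ ^ k • nthDeriv n f x := rfl

theorem seminorm_le_norm_weightedDeriv (k n : ℕ) (f : 𝓢(E, G)) :
    SchwartzMap.seminorm ℝ k n f ≤ ‖weightedDeriv k n f‖ := by
  refine SchwartzMap.seminorm_le_bound ℝ k n f (norm_nonneg _) fun x => ?_
  have := (weightedDeriv k n f).norm_coe_le_norm x
  rwa [weightedDeriv_apply, norm_smul, norm_pow, norm_norm, norm_nthDeriv] at this

/-- A closed subspace of a Banach space is complete, so the integral can be formed inside it. Its
isometric inclusion commutes with the Bochner integral even when the integrand is not integrable. -/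
theorem integral_mem_of_isClosed {Y A : Type*} [NormedAddCommGroup Y] [NormedSpace ℝ Y]
    [CompleteSpace Y] [MeasurableSpace A] (μ : Measure A) (M : Submodule ℝ Y)
    (hM : IsClosed (M : Set Y)) (f : A → Y) (hf : ∀ a, f a ∈ M) : ∫ a, f a ∂μ ∈ M := by
  have : CompleteSpace M := hM.completeSpace_coe
  have h := M.subtypeₗᵢ.integral_comp_comm (μ := μ) (fun a => (⟨f a, hf a⟩ : M))
  have e : ∫ a, f a ∂μ = M.subtypeₗᵢ (∫ a, (⟨f a, hf a⟩ : M) ∂μ) := h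
  rw [e]
  exact Submodule.coe_mem _

variable [TopologicalSpace A] [SecondCountableTopology A] [MeasurableSpace A]
  [OpensMeasurableSpace A]

theorem exists_norm_le_sum_seminorm {H : Type*} [NormedAddCommGroup H] [NormedSpace ℝ H]
    (T : 𝓢(E, G) →L[ℝ] H) : ∃ (s : Finset (ℕ × ℕ)) (C : ℝ), 0 ≤ C ∧
      ∀ f, ‖T f‖ ≤ C * ∑ m ∈ s, SchwartzMap.seminorm ℝ m.1 m.2 f := by
  let q : Seminorm ℝ 𝓢(E, G) := (normSeminorm ℝ H).comp T.toLinearMap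
  have hq : Continuous q := continuous_norm.comp T.continuous
  obtain ⟨s, C, -, hs⟩ := Seminorm.bound_of_continuous (schwartz_withSeminorms ℝ E G) q hq
  refine ⟨s, C, C.2, fun f => (hs f).trans ?_⟩
  rw [smul_apply, NNReal.smul_def, smul_eq_mul]
  gcongr
  refine (Seminorm.finset_sup_le_sum _ s _).trans (le_of_eq ?_)
  simp [schwartzSeminormFamily]

theorem integrable_comp_schwartz {H : Type*} [NormedAddCommGroup H] [NormedSpace ℝ H]
    (μ : Measure A) (F : A → 𝓢(E, G)) (hc : Continuous F)
    (hb : ∀ k n, Integrable (fun a => SchwartzMap.seminorm ℝ k n (F a)) μ)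
    (T : 𝓢(E, G) →L[ℝ] H) : Integrable (fun a => T (F a)) μ := by
  obtain ⟨s, C, -, h⟩ := exists_norm_le_sum_seminorm T
  refine Integrable.mono' ((integrable_finsetSum s fun m _ => hb m.1 m.2).const_mul C)
    (T.continuous.comp hc).aestronglyMeasurable (.of_forall fun a => h (F a))

theorem seminorm_fderivCLM_le (k n : ℕ) (f : 𝓢(E, G)) :
    SchwartzMap.seminorm ℝ k n (fderivCLM ℝ E G f) ≤ SchwartzMap.seminorm ℝ k (n + 1) f := by
  refine SchwartzMap.seminorm_le_bound ℝ k n _ (by positivity) fun x => ?_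
  have : ⇑(fderivCLM ℝ E G f) = fderiv ℝ f := rfl
  rw [this, norm_iteratedFDeriv_fderiv]
  exact f.le_seminorm ℝ k (n + 1) x

theorem integrable_seminorm_fderivCLM (μ : Measure A) (F : A → 𝓢(E, G)) (hc : Continuous F)
    (hb : ∀ k n, Integrable (fun a => SchwartzMap.seminorm ℝ k n (F a)) μ) (k n : ℕ) :
    Integrable (fun a => SchwartzMap.seminorm ℝ k n (fderivCLM ℝ E G (F a))) μ := by
  refine (hb k (n + 1)).mono' ?_ (.of_forall fun a => ?_)
  · exact (((schwartz_withSeminorms ℝ E (E →L[ℝ] G)).continuous_seminorm (k, n)).comp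
      ((fderivCLM ℝ E G).continuous.comp hc)).aestronglyMeasurable
  · rw [Real.norm_of_nonneg (by positivity)]
    exact seminorm_fderivCLM_le k n (F a)

/-- Differentiation under the integral sign; the seminorm of order (0, 1) dominates the derivative
at all points at once. -/
theorem hasFDerivAt_integral_schwartz (μ : Measure A) (F : A → 𝓢(E, G)) (hc : Continuous F)
    (hb : ∀ k n, Integrable (fun a => SchwartzMap.seminorm ℝ k n (F a)) μ) (x : E) :
    HasFDerivAt (fun x => ∫ a, F a x ∂μ) (∫ a, fderivCLM ℝ E G (F a) x ∂μ) x := by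
  have hev {G' : Type} [NormedAddCommGroup G'] [NormedSpace ℝ G'] (x : E) :
      Continuous fun f : 𝓢(E, G') => f x :=
    (BoundedContinuousFunction.evalCLM ℝ x).continuous.comp
      (toBoundedContinuousFunctionCLM ℝ E G').continuous
  have hm (x : E) : AEStronglyMeasurable (fun a => F a x) μ :=
    ((hev x).comp hc).aestronglyMeasurable
  refine hasFDerivAt_integral_of_dominated_of_fderiv_le
    (bound := fun a => SchwartzMap.seminorm ℝ 0 1 (F a))
    (F' := fun x a => fderivCLM ℝ E G (F a) x) Filter.univ_mem ?_ ?_ ?_ ?_ (hb 0 1) ?_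
  · exact .of_forall hm
  · exact (hb 0 0).mono' (hm x) (.of_forall fun a => (F a).norm_le_seminorm ℝ x)
  · exact ((hev x).comp ((fderivCLM ℝ E G).continuous.comp hc)).aestronglyMeasurable
  · refine .of_forall fun a x _ => ?_
    have := (F a).norm_iteratedFDeriv_le_seminorm ℝ 1 x
    rwa [← norm_iteratedFDeriv_fderiv, norm_iteratedFDeriv_zero] at this
  · exact .of_forall fun a x _ => ((F a).differentiable x).hasFDerivAt

/-- The target space varies in the induction, because the inductive step passes to the derivatives,
with values in `E →L[ℝ] G`. -/
theorem iteratedFDeriv_integral_schwartz (μ : Measure A) (n : ℕ) :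
    ∀ (G : Type) [NormedAddCommGroup G] [NormedSpace ℝ G] (F : A → 𝓢(E, G)) (_ : Continuous F)
    (_ : ∀ k n, Integrable (fun a => SchwartzMap.seminorm ℝ k n (F a)) μ) (x : E),
    iteratedFDeriv ℝ n (fun x => ∫ a, F a x ∂μ) x = ∫ a, iteratedFDeriv ℝ n (F a) x ∂μ := by
  induction n with
  | zero =>
    intro G _ _ F hc hb x
    simp only [iteratedFDeriv_zero_eq_comp, Function.comp_apply]
    exact (ContinuousLinearEquiv.integral_comp_comm
      (continuousMultilinearCurryFin0 ℝ E G).symm.toContinuousLinearEquiv _).symm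
  | succ n ih =>
    intro G _ _ F hc hb x
    simp only [iteratedFDeriv_succ_eq_comp_right, Function.comp_apply]
    have e : (fun y => fderiv ℝ (fun x => ∫ a, F a x ∂μ) y) =
        fun y => ∫ a, fderivCLM ℝ E G (F a) y ∂μ := by
      ext1 y; exact (hasFDerivAt_integral_schwartz μ F hc hb y).fderiv
    rw [e, ih (E →L[ℝ] G) (fun a => fderivCLM ℝ E G (F a))
      ((fderivCLM ℝ E G).continuous.comp hc) (integrable_seminorm_fderivCLM μ F hc hb) x]
    exact (ContinuousLinearEquiv.integral_comp_comm (E := DerivSpace E (E →L[ℝ] G) n)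
      (F := DerivSpace E G (n + 1)) (𝕜 := ℝ) (μ := μ)
      (continuousMultilinearCurryRightEquiv' ℝ n E G).symm.toContinuousLinearEquiv _).symm

/-- Finitely many weighted derivatives. -/
noncomputable def weightedDerivs (s : Finset (ℕ × ℕ)) :
    𝓢(E, G) →L[ℝ] (∀ m : s, BoundedContinuousFunction E (DerivSpace E G m.1.2)) :=
  ContinuousLinearMap.pi fun m => weightedDeriv m.1.1 m.1.2

/-- Projections to a component and evaluations at a point are continuous and jointly separate
points, so the Bochner integral in the target may be computed pointwise. There the claim is
differentiation under the integral sign. -/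
theorem weightedDerivs_integral_schwartz [CompleteSpace G] (μ : Measure A) (F : A → 𝓢(E, G))
    (hc : Continuous F)
    (hb : ∀ k n, Integrable (fun a => SchwartzMap.seminorm ℝ k n (F a)) μ)
    (Φ : 𝓢(E, G)) (hΦ : ∀ x, Φ x = ∫ a, F a x ∂μ) (s : Finset (ℕ × ℕ)) :
    weightedDerivs s Φ = ∫ a, weightedDerivs s (F a) ∂μ := by
  have hi := integrable_comp_schwartz μ F hc hb (weightedDerivs (E := E) (G := G) s)
  funext m
  have h1 := (ContinuousLinearMap.proj (R := ℝ) (φ := fun m : s =>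
    BoundedContinuousFunction E (DerivSpace E G m.1.2)) m).integral_comp_comm hi
  refine Eq.trans ?_ h1
  ext1 x
  have h2 := (BoundedContinuousFunction.evalCLM ℝ x).integral_comp_comm
    (integrable_comp_schwartz μ F hc hb (weightedDeriv m.1.1 m.1.2))
  refine Eq.trans ?_ h2
  change ‖x‖ ^ m.1.1 • nthDeriv m.1.2 Φ x = ∫ a, ‖x‖ ^ m.1.1 • nthDeriv m.1.2 (F a) x ∂μ
  rw [integral_smul]
  congr 1
  have h3 := iteratedFDeriv_integral_schwartz μ m.1.2 G F hc hb x
  rw [← show (Φ : E → G) = fun x => ∫ a, F a x ∂μ from funext hΦ] at h3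
  exact h3

/-- A continuous linear map on the Schwartz space commutes with integrals of Schwartz functions. -/
theorem map_integral_schwartz {H : Type*} [NormedAddCommGroup H] [NormedSpace ℝ H]
    [CompleteSpace H] [CompleteSpace G] (μ : Measure A) (F : A → 𝓢(E, G)) (hc : Continuous F)
    (hb : ∀ k n, Integrable (fun a => SchwartzMap.seminorm ℝ k n (F a)) μ)
    (T : 𝓢(E, G) →L[ℝ] H) (Φ : 𝓢(E, G)) (hΦ : ∀ x, Φ x = ∫ a, F a x ∂μ) :
    T Φ = ∫ a, T (F a) ∂μ := by
  obtain ⟨s, C, hC, hT⟩ := exists_norm_le_sum_seminorm T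
  have hJ := weightedDerivs_integral_schwartz μ F hc hb Φ hΦ s
  have hJi := integrable_comp_schwartz μ F hc hb (weightedDerivs (E := E) (G := G) s)
  have hTi := integrable_comp_schwartz μ F hc hb T
  have hle (f : 𝓢(E, G)) : ‖T f‖ ≤ C * ∑ m : s, ‖weightedDerivs s f m‖ := by
    refine (hT f).trans ?_
    rw [← Finset.sum_coe_sort]
    change _ ≤ C * ∑ m : s, ‖weightedDeriv m.1.1 m.1.2 f‖
    gcongr
    exact seminorm_le_norm_weightedDeriv _ _ _
  generalize weightedDerivs (E := E) (G := G) s = J at hJ hJi hle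
  -- The pairs (J f, T f) satisfy ‖T f‖ ≤ C ∑ ‖J f m‖, a closed condition that persists on the
  -- closure `M` of their range. The integral of the pairs (J (F a), T (F a)) lies in `M`. Its
  -- difference from (J Φ, T Φ) has first component zero, so the second vanishes too.
  let Y := (∀ m : s, BoundedContinuousFunction E (DerivSpace E G m.1.2)) × H
  let J' := J.prod T
  let M := (LinearMap.range J'.toLinearMap).topologicalClosure
  have hM := Submodule.isClosed_topologicalClosure (LinearMap.range J'.toLinearMap)
  have hmem (f : 𝓢(E, G)) : J' f ∈ M :=
    Submodule.le_topologicalClosure _ (LinearMap.mem_range_self J'.toLinearMap f)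
  have h1 : J' Φ - ∫ a, J' (F a) ∂μ ∈ M :=
    M.sub_mem (hmem Φ) (integral_mem_of_isClosed μ M hM _ fun a => hmem _)
  have h2 : (M : Set Y) ⊆ {p | ‖p.2‖ ≤ C * ∑ m : s, ‖p.1 m‖} := by
    refine closure_minimal ?_ (isClosed_le (by fun_prop) (by fun_prop))
    rintro _ ⟨f, rfl⟩
    exact hle f
  have h3 := h2 h1
  have e : ∫ a, J' (F a) ∂μ = (J Φ, ∫ a, T (F a) ∂μ) := by
    rw [hJ]; exact integral_pair hJi hTi
  rw [e] at h3
  have h4 : ‖T Φ - ∫ a, T (F a) ∂μ‖ ≤ 0 := by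
    refine h3.trans (le_of_eq ?_)
    have : J' Φ = (J Φ, T Φ) := rfl
    rw [this, Prod.mk_sub_mk, sub_self]; simp
  exact sub_eq_zero.1 (norm_le_zero_iff.1 h4)

end IntegralCommute

/-! ### Fourth moments of Gaussian vectors -/

section Wick

theorem integral_pow_four_gaussianReal (v : NNReal) :
    ∫ x, x ^ 4 ∂gaussianReal 0 v = 3 * (v : ℝ) ^ 2 := by
  have h : ∫ x, x ^ 4 ∂gaussianReal 0 v =
      iteratedDeriv 4 (mgf (fun x ↦ x) (gaussianReal 0 v)) 0 := by
    rw [iteratedDeriv_mgf_zero] <;> simp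
  -- The moment is the fourth derivative at 0 of exp(v t² / 2). Each differentiation replaces the
  -- factor q in front of the exponential by q' + q v t, so it is enough to follow this factor four
  -- times.
  have hd (q q' : ℝ → ℝ) (hq : ∀ t, HasDerivAt q (q' t) t) :
      deriv (fun t => q t * Real.exp (v * t ^ 2 / 2)) =
        fun t => (q' t + q t * (v * t)) * Real.exp (v * t ^ 2 / 2) := by
    ext t
    have h1 : HasDerivAt (fun t : ℝ => (v : ℝ) * t ^ 2 / 2) (v * t) t := by
      have := ((hasDerivAt_pow 2 t).const_mul (v : ℝ)).div_const 2
      refine this.congr_deriv ?_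
      push_cast; ring
    have h2 := ((hq t).mul h1.exp).deriv
    refine Eq.trans h2 ?_
    ring
  have e0 : mgf (fun x ↦ x) (gaussianReal 0 v) =
      fun t : ℝ => (1 : ℝ) * Real.exp (v * t ^ 2 / 2) := by
    rw [mgf_fun_id_gaussianReal]; ext t; simp
  rw [h, e0, iteratedDeriv_succ, iteratedDeriv_succ, iteratedDeriv_succ, iteratedDeriv_one,
    hd (fun _ => 1) (fun _ => 0) (fun t => hasDerivAt_const t _)]
  rw [hd (fun t => 0 + 1 * (v * t)) (fun _ => v) (fun t => by
    simpa using (hasDerivAt_id t).const_mul (v : ℝ))]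
  rw [hd (fun t => v + (0 + 1 * (v * t)) * (v * t)) (fun t => 2 * v ^ 2 * t) (fun t => by
    have := (((hasDerivAt_pow 2 t).const_mul ((v : ℝ) ^ 2)).const_add (v : ℝ))
    refine (this.congr_deriv ?_).congr_of_eventuallyEq (.of_forall fun t => ?_)
    · push_cast; ring
    · dsimp only; ring)]
  rw [hd (fun t => 2 * v ^ 2 * t + (v + (0 + 1 * (v * t)) * (v * t)) * (v * t))
    (fun t => 3 * v ^ 2 + 3 * v ^ 3 * t ^ 2) (fun t => by
    have := ((hasDerivAt_id t).const_mul (3 * (v : ℝ) ^ 2)).add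
      ((hasDerivAt_pow 3 t).const_mul ((v : ℝ) ^ 3))
    refine (this.congr_deriv ?_).congr_of_eventuallyEq (.of_forall fun t => ?_)
    · push_cast; ring
    · simp only [id_eq, Pi.add_apply]; ring)]
  simp

variable {Ω : Type*} [MeasurableSpace Ω] {P : Measure Ω}

theorem integral_pow_four_of_hasGaussianLaw {X : Ω → ℝ} (hX : HasGaussianLaw X P)
    (h0 : ∫ ω, X ω ∂P = 0) : ∫ ω, X ω ^ 4 ∂P = 3 * (∫ ω, X ω ^ 2 ∂P) ^ 2 := by
  have h1 : ∫ ω, X ω ^ 4 ∂P = ∫ x, x ^ 4 ∂(P.map X) :=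
    (integral_map hX.aemeasurable
      (continuous_pow 4).aestronglyMeasurable).symm
  have h2 : Var[X; P] = ∫ ω, X ω ^ 2 ∂P := by
    rw [variance_eq_integral hX.aemeasurable, h0]; simp
  rw [h1, hX.map_eq_gaussianReal, h0, integral_pow_four_gaussianReal,
    Real.coe_toNNReal _ (variance_nonneg _ _), h2]

theorem memLp_two_mul {𝕜 : Type*} [RCLike 𝕜] {f g : Ω → 𝕜} (hf : MemLp f 4 P) (hg : MemLp g 4 P) :
    MemLp (fun ω => f ω * g ω) 2 P := by
  have : ENNReal.HolderTriple 4 4 2 := ⟨by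
    rw [show (4 : ENNReal) = 2 * 2 by norm_num, ENNReal.mul_inv (by simp) (by simp), ← mul_add,
      ENNReal.inv_two_add_inv_two, mul_one]⟩
  exact hg.mul hf

theorem integrable_mul_four {𝕜 : Type*} [RCLike 𝕜] {a b c d : Ω → 𝕜} (ha : MemLp a 4 P)
    (hb : MemLp b 4 P) (hc : MemLp c 4 P) (hd : MemLp d 4 P) :
    Integrable (fun ω => a ω * b ω * (c ω * d ω)) P :=
  (memLp_two_mul ha hb).integrable_mul (memLp_two_mul hc hd)

/-- Four random variables obey the moment formula of Isserlis and Wick. -/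
def WickFormula {𝕜 : Type*} [RCLike 𝕜] (P : Measure Ω) (a b c d : Ω → 𝕜) : Prop :=
  ∫ ω, a ω * b ω * (c ω * d ω) ∂P =
    (∫ ω, a ω * b ω ∂P) * (∫ ω, c ω * d ω ∂P) + (∫ ω, a ω * c ω ∂P) * (∫ ω, b ω * d ω ∂P) +
      (∫ ω, a ω * d ω ∂P) * (∫ ω, b ω * c ω ∂P)

/-- A cyclic shift permutes the three pairings. It brings each entry in turn to the first place,
where `WickFormula.add_mul` applies. -/
theorem WickFormula.rotate {𝕜 : Type*} [RCLike 𝕜] {a b c d : Ω → 𝕜} (h : WickFormula P a b c d) :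
    WickFormula P b c d a := by
  unfold WickFormula at *
  have e (x y : Ω → 𝕜) : ∫ ω, x ω * y ω ∂P = ∫ ω, y ω * x ω ∂P := by simp only [mul_comm]
  have e4 : ∫ ω, b ω * c ω * (d ω * a ω) ∂P = ∫ ω, a ω * b ω * (c ω * d ω) ∂P :=
    integral_congr_ae (.of_forall fun ω => by ring)
  rw [e4, h, e b a, e c a, e d a]
  ring

theorem WickFormula.add_mul [IsProbabilityMeasure P] {x y b c d : Ω → ℂ} (r : ℂ)
    (hx : MemLp x 4 P) (hy : MemLp y 4 P)
    (hb : MemLp b 4 P) (hc : MemLp c 4 P) (hd : MemLp d 4 P)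
    (h1 : WickFormula P x b c d) (h2 : WickFormula P y b c d) :
    WickFormula P (fun ω => x ω + r * y ω) b c d := by
  unfold WickFormula at *
  have e (z : Ω → ℂ) (hz : MemLp z 4 P) : ∫ ω, (x ω + r * y ω) * z ω ∂P =
      ∫ ω, x ω * z ω ∂P + r * ∫ ω, y ω * z ω ∂P := by
    rw [← integral_const_mul, ← integral_add]
    · exact integral_congr_ae (.of_forall fun ω => by ring)
    · exact (memLp_two_mul hx hz).integrable (by norm_num)
    · exact ((memLp_two_mul hy hz).integrable (by norm_num)).const_mul r
  have e4 : ∫ ω, (x ω + r * y ω) * b ω * (c ω * d ω) ∂P =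
      ∫ ω, x ω * b ω * (c ω * d ω) ∂P + r * ∫ ω, y ω * b ω * (c ω * d ω) ∂P := by
    rw [← integral_const_mul, ← integral_add]
    · exact integral_congr_ae (.of_forall fun ω => by ring)
    · exact integrable_mul_four hx hb hc hd
    · exact (integrable_mul_four hy hb hc hd).const_mul r
  rw [e4, e b hb, e c hc, e d hd, h1, h2]
  ring

theorem WickFormula.ofReal {a b c d : Ω → ℝ} (h : WickFormula P a b c d) :
    WickFormula P (fun ω => (a ω : ℂ)) (fun ω => (b ω : ℂ)) (fun ω => (c ω : ℂ))
      (fun ω => (d ω : ℂ)) := by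
  unfold WickFormula at *
  simp only [← Complex.ofReal_mul, integral_complex_ofReal]
  rw [h]; push_cast; ring

/-- Polarization of E L⁴ = 3 (E L²)², which holds for every linear combination L of the entries
because L is a centered Gaussian variable. The identity is taken for L = X₀ ± X₁ ± X₂ ± X₃ and
averaged against the product of the three signs. -/
theorem wickFormula_of_hasGaussianLaw {ι : Type*} [Fintype ι] {X : Ω → ι → ℝ}
    (hX : HasGaussianLaw X P) (h0 : ∀ i, ∫ ω, X ω i ∂P = 0) (t : Fin 4 → ι) :
    WickFormula P (fun ω => X ω (t 0)) (fun ω => X ω (t 1)) (fun ω => X ω (t 2))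
      (fun ω => X ω (t 3)) := by
  have := hX.isProbabilityMeasure
  have hm (i : ι) : MemLp (fun ω => X ω i) 4 P :=
    (hX.map_fun (ContinuousLinearMap.proj i)).memLp (by simp)
  have hi (i j : ι) : Integrable (fun ω => X ω i * X ω j) P :=
    (memLp_two_mul (hm i) (hm j)).integrable (by norm_num)
  let L (s : Fin 4 → ℝ) (ω : Ω) : ℝ := ∑ a, s a * X ω (t a)
  have hL (s : Fin 4 → ℝ) : HasGaussianLaw (L s) P := by
    have := hX.map_fun (∑ a, s a • ContinuousLinearMap.proj (R := ℝ) (φ := fun _ => ℝ) (t a))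
    refine this.congr (.of_forall fun ω => ?_)
    simp [L]
  have hL0 (s : Fin 4 → ℝ) : ∫ ω, L s ω ∂P = 0 := by
    rw [integral_finsetSum _ fun a _ => ((hm (t a)).integrable (by norm_num)).const_mul _]
    simp [integral_const_mul, h0]
  have hL2 (s : Fin 4 → ℝ) : ∫ ω, L s ω ^ 2 ∂P =
      ∑ a, ∑ b, s a * s b * ∫ ω, X ω (t a) * X ω (t b) ∂P := by
    have e (ω : Ω) : L s ω ^ 2 = ∑ a, ∑ b, s a * s b * (X ω (t a) * X ω (t b)) := by
      rw [sq, Finset.sum_mul_sum]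
      exact Finset.sum_congr rfl fun a _ => Finset.sum_congr rfl fun b _ => by ring
    simp only [e]
    rw [integral_finsetSum _ fun a _ => integrable_finsetSum _ fun b _ => (hi _ _).const_mul _]
    refine Finset.sum_congr rfl fun a _ => ?_
    rw [integral_finsetSum _ fun b _ => (hi _ _).const_mul _]
    exact Finset.sum_congr rfl fun b _ => integral_const_mul _ _
  have hL4 (s : Fin 4 → ℝ) := integral_pow_four_of_hasGaussianLaw (hL s) (hL0 s)
  have hLi (s : Fin 4 → ℝ) : Integrable (fun ω => L s ω ^ 4) P := by
    have h := (hL s).memLp (p := 4) (by simp)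
    refine (integrable_mul_four h h h h).congr (.of_forall fun ω => ?_)
    ring
  let S : Finset (ℝ × ℝ × ℝ) := {1, -1} ×ˢ {1, -1} ×ˢ {1, -1}
  have hS (f : ℝ × ℝ × ℝ → ℝ) : ∑ e ∈ S, f e = f (1, 1, 1) + f (1, 1, -1) +
      (f (1, -1, 1) + f (1, -1, -1)) + (f (-1, 1, 1) + f (-1, 1, -1) +
      (f (-1, -1, 1) + f (-1, -1, -1))) := by
    have h : (1 : ℝ) ≠ -1 := by norm_num
    simp only [S, Finset.sum_product, Finset.sum_pair h]
  have hpol : ∫ ω, ∑ e ∈ S, e.1 * e.2.1 * e.2.2 * L ![1, e.1, e.2.1, e.2.2] ω ^ 4 ∂P =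
      ∑ e ∈ S, e.1 * e.2.1 * e.2.2 * ∫ ω, L ![1, e.1, e.2.1, e.2.2] ω ^ 4 ∂P := by
    rw [integral_finsetSum _ fun e _ => (hLi _).const_mul _]
    exact Finset.sum_congr rfl fun e _ => integral_const_mul _ _
  -- The signed sum keeps only monomials of odd degree in X₁, X₂ and X₃, that is X₀X₁X₂X₃. Its
  -- coefficient is 4! in each of the 8 terms, hence 192.
  have hprod : ∫ ω, ∑ e ∈ S, e.1 * e.2.1 * e.2.2 * L ![1, e.1, e.2.1, e.2.2] ω ^ 4 ∂P =
      192 * ∫ ω, X ω (t 0) * X ω (t 1) * (X ω (t 2) * X ω (t 3)) ∂P := by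
    rw [← integral_const_mul]
    refine integral_congr_ae (.of_forall fun ω => ?_)
    simp only [hS, L, Fin.sum_univ_four, Matrix.cons_val]
    ring
  have e (i j : ι) : ∫ ω, X ω i * X ω j ∂P = ∫ ω, X ω j * X ω i ∂P := by simp only [mul_comm]
  unfold WickFormula
  have key := hprod.symm.trans hpol
  simp only [hS, hL4, hL2, Fin.sum_univ_four, Matrix.cons_val] at key
  rw [e (t 1) (t 0), e (t 2) (t 0), e (t 3) (t 0), e (t 2) (t 1), e (t 3) (t 1),
    e (t 3) (t 2)] at key
  linear_combination key / 192

end Wick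

/-! ### Second moments of products of values of the process -/

section GaussianProcess

variable {V : Type} [NormedAddCommGroup V] [NormedSpace ℝ V]
  {Ω : Type*} [MeasurableSpace Ω] {P : Measure Ω}

/-- A continuous conjugate linear map as a real linear map. -/
noncomputable def realCLM {H : Type*} [NormedAddCommGroup H] [NormedSpace ℂ H] [NormedSpace ℝ H]
    [IsScalarTower ℝ ℂ H] (T : 𝓢(V, ℂ) →L⋆[ℂ] H) : 𝓢(V, ℂ) →L[ℝ] H where
  toFun := T
  map_add' := map_add T
  map_smul' c φ := by
    have h : c • φ = (c : ℂ) • φ := by ext x; simp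
    rw [h, T.map_smulₛₗ, Complex.conj_ofReal, RingHom.id_apply, ← algebraMap_smul ℂ c (T φ)]; rfl
  cont := T.continuous

theorem realCLM_apply {H : Type*} [NormedAddCommGroup H] [NormedSpace ℂ H] [NormedSpace ℝ H]
    [IsScalarTower ℝ ℂ H] (T : 𝓢(V, ℂ) →L⋆[ℂ] H) (φ : 𝓢(V, ℂ)) : realCLM T φ = T φ := rfl

theorem IsGaussianGSP.memLp_four {u : TemperedGSP V P} (hu : IsGaussianGSP u) (φ : 𝓢(V, ℂ)) :
    MemLp (u φ) 4 P := by
  have h := hu 1 fun _ => φ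
  have h1 : MemLp (fun ω => (u φ ω).re) 4 P :=
    (h.map_fun (ContinuousLinearMap.proj (Sum.inl 0))).memLp (by simp)
  have h2 : MemLp (fun ω => (u φ ω).im) 4 P :=
    (h.map_fun (ContinuousLinearMap.proj (Sum.inr 0))).memLp (by simp)
  have e : (fun ω => ((u φ ω).re : ℂ) + Complex.I * ((u φ ω).im : ℂ)) = u φ :=
    funext fun ω => by rw [mul_comm]; exact Complex.re_add_im _
  rw [← e]
  exact (h1.ofReal (K := ℂ)).add ((h2.ofReal (K := ℂ)).const_mul Complex.I)

theorem memLp_conj {f : Ω → ℂ} {p : ENNReal} (hf : MemLp f p P) :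
    MemLp (fun ω => conj (f ω)) p P := hf.star

theorem integral_re_eq_zero {u : TemperedGSP V P} [IsFiniteMeasure P] (hmean : IsZeroMean u)
    (φ : 𝓢(V, ℂ)) : ∫ ω, (u φ ω).re ∂P = 0 ∧ ∫ ω, (u φ ω).im ∂P = 0 := by
  have hi : Integrable (u φ) P := (Lp.memLp (u φ)).integrable (by norm_num)
  have h := hmean φ
  have h1 : ∫ ω, (u φ ω).re ∂P = (∫ ω, u φ ω ∂P).re := integral_re hi
  have h2 : ∫ ω, (u φ ω).im ∂P = (∫ ω, u φ ω ∂P).im := integral_im hi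
  rw [h1, h2, h]; simp

/-- Multilinearity carries the formula from real Gaussian variables to complex combinations of them,
such as a complex variable or its conjugate in terms of real and imaginary parts. The entries are
replaced one at a time, with a rotation after each; four rotations restore the order. -/
theorem wickFormula_affine [IsProbabilityMeasure P] {ι : Type*} [Fintype ι] {X : Ω → ι → ℝ}
    (hX : HasGaussianLaw X P) (h0 : ∀ i, ∫ ω, X ω i ∂P = 0) (s t : Fin 4 → ι) (r : Fin 4 → ℂ) :
    WickFormula P (fun ω => (X ω (s 0) : ℂ) + r 0 * X ω (t 0))
      (fun ω => (X ω (s 1) : ℂ) + r 1 * X ω (t 1)) (fun ω => (X ω (s 2) : ℂ) + r 2 * X ω (t 2))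
      (fun ω => (X ω (s 3) : ℂ) + r 3 * X ω (t 3)) := by
  have hm (i : ι) : MemLp (fun ω => (X ω i : ℂ)) 4 P :=
    ((hX.map_fun (ContinuousLinearMap.proj i)).memLp (by simp)).ofReal
  have hz (i : Fin 4) : MemLp (fun ω => (X ω (s i) : ℂ) + r i * X ω (t i)) 4 P :=
    (hm _).add ((hm _).const_mul _)
  have H0 (i j k l : ι) : WickFormula P (fun ω => (X ω i : ℂ)) (fun ω => (X ω j : ℂ))
      (fun ω => (X ω k : ℂ)) (fun ω => (X ω l : ℂ)) :=
    (wickFormula_of_hasGaussianLaw hX h0 ![i, j, k, l]).ofReal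
  have H1 (j k l : ι) := (WickFormula.add_mul (r 0) (hm (s 0)) (hm (t 0)) (hm j) (hm k) (hm l)
    (H0 _ _ _ _) (H0 _ _ _ _)).rotate
  have H2 (k l : ι) := (WickFormula.add_mul (r 1) (hm (s 1)) (hm (t 1)) (hm k) (hm l) (hz 0)
    (H1 _ _ _) (H1 _ _ _)).rotate
  have H3 (l : ι) := (WickFormula.add_mul (r 2) (hm (s 2)) (hm (t 2)) (hm l) (hz 0) (hz 1)
    (H2 _ _) (H2 _ _)).rotate
  exact (WickFormula.add_mul (r 3) (hm (s 3)) (hm (t 3)) (hz 0) (hz 1) (hz 2)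
    (H3 _) (H3 _)).rotate

theorem wickFormula_gsp [IsProbabilityMeasure P] {u : TemperedGSP V P} (hmean : IsZeroMean u)
    (hgauss : IsGaussianGSP u) (φ₁ φ₂ φ₃ φ₄ : 𝓢(V, ℂ)) :
    WickFormula P (u φ₁) (fun ω => conj (u φ₂ ω)) (fun ω => conj (u φ₃ ω)) (u φ₄) := by
  have hX := hgauss 4 ![φ₁, φ₂, φ₃, φ₄]
  have h0 (i : Fin 4 ⊕ Fin 4) : ∫ ω, (Sum.elim (fun i => (u (![φ₁, φ₂, φ₃, φ₄] i) ω).re)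
      (fun i => (u (![φ₁, φ₂, φ₃, φ₄] i) ω).im) : Fin 4 ⊕ Fin 4 → ℝ) i ∂P = 0 := by
    rcases i with i | i
    · exact (integral_re_eq_zero hmean _).1
    · exact (integral_re_eq_zero hmean _).2
  -- The coefficient of the imaginary part is -i in the second and third entries, which are
  -- conjugated.
  have h := wickFormula_affine hX h0 Sum.inl Sum.inr
    ![Complex.I, -Complex.I, -Complex.I, Complex.I]
  have e1 (z : ℂ) : (z.re : ℂ) + Complex.I * z.im = z := by
    rw [mul_comm]; exact Complex.re_add_im z
  have e2 (z : ℂ) : (z.re : ℂ) + -Complex.I * z.im = conj z := by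
    apply Complex.ext <;> simp
  simpa only [Sum.elim_inl, Sum.elim_inr, Matrix.cons_val, e1, e2] using h

/-- Symmetry under multiplication by i multiplies this moment by i² = -1. -/
theorem integral_mul_eq_zero_of_isSymmetric {u : TemperedGSP V P} (hsymm : IsSymmetricGSP u)
    (φ ψ : 𝓢(V, ℂ)) : ∫ ω, u φ ω * u ψ ω ∂P = 0 := by
  have h := (hsymm Complex.I (by simp) 2 ![φ, ψ]).comp
    (u := fun z : Fin 2 → ℂ => z 0 * z 1) (by fun_prop)
  have h1 := h.integral_eq
  simp only [Function.comp_def, Matrix.cons_val] at h1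
  have h2 : ∫ ω, Complex.I * u φ ω * (Complex.I * u ψ ω) ∂P = -∫ ω, u φ ω * u ψ ω ∂P := by
    rw [← integral_neg]
    refine integral_congr_ae (.of_forall fun ω => ?_)
    linear_combination (u φ ω * u ψ ω) * Complex.I_mul_I
  rw [h2] at h1
  linear_combination -h1 / 2

/-- The second moments of the products `(u, φ) conj (u, ψ)`. -/
theorem integral_mul_conj_mul_conj [IsProbabilityMeasure P] {u : TemperedGSP V P}
    (hmean : IsZeroMean u) (hgauss : IsGaussianGSP u) (hsymm : IsSymmetricGSP u)
    (φ ψ φ' ψ' : 𝓢(V, ℂ)) :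
    ∫ ω, u φ ω * conj (u ψ ω) * conj (u φ' ω * conj (u ψ' ω)) ∂P =
      (∫ ω, u φ ω * conj (u ψ ω) ∂P) * conj (∫ ω, u φ' ω * conj (u ψ' ω) ∂P) +
      (∫ ω, u φ ω * conj (u φ' ω) ∂P) * ∫ ω, u ψ' ω * conj (u ψ ω) ∂P := by
  have h := wickFormula_gsp hmean hgauss φ ψ φ' ψ'
  unfold WickFormula at h
  -- The pairing of the two unconjugated variables drops out.
  rw [integral_mul_eq_zero_of_isSymmetric hsymm φ ψ', zero_mul, add_zero] at h
  have e1 : ∫ ω, u φ ω * conj (u ψ ω) * conj (u φ' ω * conj (u ψ' ω)) ∂P =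
      ∫ ω, u φ ω * conj (u ψ ω) * (conj (u φ' ω) * u ψ' ω) ∂P :=
    integral_congr_ae (.of_forall fun ω => by simp only [map_mul, Complex.conj_conj])
  have e2 : conj (∫ ω, u φ' ω * conj (u ψ' ω) ∂P) = ∫ ω, conj (u φ' ω) * u ψ' ω ∂P := by
    rw [← integral_conj]
    exact integral_congr_ae (.of_forall fun ω => by simp only [map_mul, Complex.conj_conj])
  have e3 : ∫ ω, u ψ' ω * conj (u ψ ω) ∂P = ∫ ω, conj (u ψ ω) * u ψ' ω ∂P :=
    integral_congr_ae (.of_forall fun ω => mul_comm _ _)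
  rw [e1, e2, e3, h]

theorem integral_mul_conj_eq_inner (f g : Lp ℂ 2 P) : ∫ ω, f ω * conj (g ω) ∂P = inner ℂ g f := by
  rw [L2.inner_def]; rfl

/-- The product `(u, φ) conj (u, conj ψ)` in `L²`, as a form that is conjugate linear in both
variables. -/
noncomputable def productForm (u : TemperedGSP V P) (hu : ∀ φ, MemLp (u φ) 4 P) :
    𝓢(V, ℂ) →ₛₗ[starRingEnd ℂ] 𝓢(V, ℂ) →ₛₗ[starRingEnd ℂ] Lp ℂ 2 P :=
  LinearMap.mk₂'ₛₗ (starRingEnd ℂ) (starRingEnd ℂ)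
    (fun φ ψ => (memLp_two_mul (hu φ) (memLp_conj (hu (conjSchwartz ψ)))).toLp _)
    (fun φ₁ φ₂ ψ => by
      ext1
      refine (MemLp.coeFn_toLp _).trans ?_
      refine Filter.EventuallyEq.trans ?_ (Lp.coeFn_add _ _).symm
      filter_upwards [MemLp.coeFn_toLp (memLp_two_mul (hu φ₁) (memLp_conj (hu (conjSchwartz ψ)))),
        MemLp.coeFn_toLp (memLp_two_mul (hu φ₂) (memLp_conj (hu (conjSchwartz ψ)))),
        Lp.coeFn_add (u φ₁) (u φ₂)] with ω h1 h2 h3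
      rw [Pi.add_apply, h1, h2, map_add, h3, Pi.add_apply, add_mul])
    (fun c φ ψ => by
      ext1
      refine (MemLp.coeFn_toLp _).trans ?_
      refine Filter.EventuallyEq.trans ?_ (Lp.coeFn_smul _ _).symm
      filter_upwards [MemLp.coeFn_toLp (memLp_two_mul (hu φ) (memLp_conj (hu (conjSchwartz ψ)))),
        Lp.coeFn_smul (conj c) (u φ)] with ω h1 h3
      rw [Pi.smul_apply, h1, map_smulₛₗ, h3, Pi.smul_apply, smul_eq_mul, smul_eq_mul, mul_assoc])
    (fun φ ψ₁ ψ₂ => by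
      ext1
      refine (MemLp.coeFn_toLp _).trans ?_
      refine Filter.EventuallyEq.trans ?_ (Lp.coeFn_add _ _).symm
      have e : conjSchwartz (ψ₁ + ψ₂) = conjSchwartz ψ₁ + conjSchwartz ψ₂ := map_add _ _ _
      filter_upwards [MemLp.coeFn_toLp (memLp_two_mul (hu φ) (memLp_conj (hu (conjSchwartz ψ₁)))),
        MemLp.coeFn_toLp (memLp_two_mul (hu φ) (memLp_conj (hu (conjSchwartz ψ₂)))),
        Lp.coeFn_add (u (conjSchwartz ψ₁)) (u (conjSchwartz ψ₂))] with ω h1 h2 h3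
      rw [Pi.add_apply, h1, h2, e, map_add, h3, Pi.add_apply, map_add, mul_add])
    (fun c φ ψ => by
      ext1
      refine (MemLp.coeFn_toLp _).trans ?_
      refine Filter.EventuallyEq.trans ?_ (Lp.coeFn_smul _ _).symm
      have e : conjSchwartz (c • ψ) = conj c • conjSchwartz ψ := by
        ext x; simp [conjSchwartz_apply]
      filter_upwards [MemLp.coeFn_toLp (memLp_two_mul (hu φ) (memLp_conj (hu (conjSchwartz ψ)))),
        Lp.coeFn_smul c (u (conjSchwartz ψ))] with ω h1 h3
      rw [Pi.smul_apply, h1, e, map_smulₛₗ, Complex.conj_conj, h3, Pi.smul_apply, smul_eq_mul,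
        smul_eq_mul, map_mul]
      ring)

theorem productForm_apply (u : TemperedGSP V P) (hu : ∀ φ, MemLp (u φ) 4 P) (φ ψ : 𝓢(V, ℂ)) :
    productForm u hu φ ψ =ᵐ[P] fun ω => u φ ω * conj (u (conjSchwartz ψ) ω) :=
  MemLp.coeFn_toLp (memLp_two_mul (hu φ) (memLp_conj (hu (conjSchwartz ψ))))

/-- The moment formula with equal pairs gives ‖B‖² = |⟨u χ, u φ⟩|² + ‖u φ‖² ‖u χ‖², where χ = conj
ψ, and Cauchy–Schwarz bounds the first term by the second. -/
theorem norm_productForm_le [IsProbabilityMeasure P] {u : TemperedGSP V P}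
    (hmean : IsZeroMean u) (hgauss : IsGaussianGSP u) (hsymm : IsSymmetricGSP u)
    (φ ψ : 𝓢(V, ℂ)) : ‖productForm u hgauss.memLp_four φ ψ‖ ≤
      2 * (‖u φ‖ * ‖u (conjSchwartz ψ)‖) := by
  set B := productForm u hgauss.memLp_four φ ψ with hB
  set χ := conjSchwartz ψ
  have h1 : inner ℂ B B = inner ℂ (u χ) (u φ) * conj (inner ℂ (u χ) (u φ)) +
      inner ℂ (u φ) (u φ) * inner ℂ (u χ) (u χ) := by
    simp only [← integral_mul_conj_eq_inner]
    rw [← integral_mul_conj_mul_conj hmean hgauss hsymm φ χ φ χ]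
    refine integral_congr_ae ?_
    filter_upwards [productForm_apply u hgauss.memLp_four φ ψ] with ω hω
    rw [hB, hω]
  have h2 : ‖B‖ ^ 2 ≤ 2 * (‖u φ‖ * ‖u χ‖) ^ 2 := by
    have h3 : ‖inner ℂ B B‖ = ‖B‖ ^ 2 := by
      rw [inner_self_eq_norm_sq_to_K]; simp
    rw [← h3, h1]
    refine (norm_add_le _ _).trans ?_
    rw [norm_mul, norm_mul, Complex.norm_conj]
    have a1 := norm_inner_le_norm (𝕜 := ℂ) (u χ) (u φ)
    have a2 := norm_inner_le_norm (𝕜 := ℂ) (u φ) (u φ)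
    have a3 := norm_inner_le_norm (𝕜 := ℂ) (u χ) (u χ)
    calc _ ≤ (‖u χ‖ * ‖u φ‖) * (‖u χ‖ * ‖u φ‖) + (‖u φ‖ * ‖u φ‖) * (‖u χ‖ * ‖u χ‖) := by gcongr
      _ = _ := by ring
  -- The constant √2 is relaxed to 2.
  refine abs_le_of_sq_le_sq' (h2.trans ?_) (by positivity) |>.2
  nlinarith [sq_nonneg (‖u φ‖ * ‖u χ‖)]

end GaussianProcess

/-! ### Parametrized families of Schwartz functions and tensor products -/

section Slices

open scoped ContDiff
open Filter Topology

variable {A V W : Type} [NormedAddCommGroup A] [NormedSpace ℝ A] [NormedAddCommGroup V]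
  [NormedSpace ℝ V] [NormedAddCommGroup W] [NormedSpace ℝ W]

theorem iteratedFDeriv_slice {f : A × V → ℂ} (hf : ContDiff ℝ ∞ f) (w : A) (x : V) (n : ℕ) :
    iteratedFDeriv ℝ n (fun x => f (w, x)) x = (iteratedFDeriv ℝ n f (w, x)).compContinuousLinearMap
      fun _ => ContinuousLinearMap.inr ℝ A V := by
  have hc : ContDiff ℝ n (fun z => f ((w, (0 : V)) + z)) :=
    (hf.of_le (mod_cast le_top)).comp (contDiff_const.add contDiff_id)
  have e : (fun x => f (w, x)) =
      (fun z => f ((w, (0 : V)) + z)) ∘ ContinuousLinearMap.inr ℝ A V := by ext y; simp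
  rw [e, ContinuousLinearMap.iteratedFDeriv_comp_right _ hc x le_rfl, iteratedFDeriv_comp_add_left]
  simp

theorem norm_compContinuousLinearMap_inr_le {n : ℕ} (M : (A × V) [×n]→L[ℝ] ℂ) :
    ‖M.compContinuousLinearMap fun _ => ContinuousLinearMap.inr ℝ A V‖ ≤ ‖M‖ := by
  refine (ContinuousMultilinearMap.norm_compContinuousLinearMap_le _ _).trans ?_
  have h3 : (∏ _i : Fin n, ‖ContinuousLinearMap.inr ℝ A V‖) ≤ 1 := by
    rw [Finset.prod_const]
    exact pow_le_one₀ (norm_nonneg _) (ContinuousLinearMap.norm_inr_le_one ..)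
  exact mul_le_of_le_one_right (norm_nonneg _) h3

/-- Smooth functions of a parameter `w` and a variable `x` that are rapidly decreasing in `x`,
with bounds that grow polynomially in `w`. -/
structure IsSchwartzFamily (f : A × V → ℂ) : Prop where
  contDiff : ContDiff ℝ ∞ f
  bound : ∀ k n : ℕ, ∃ (C : ℝ) (N : ℕ), 0 ≤ C ∧ ∀ w x,
    ‖x‖ ^ k * ‖iteratedFDeriv ℝ n f (w, x)‖ ≤ C * (1 + ‖w‖) ^ N

namespace IsSchwartzFamily

variable {f : A × V → ℂ}

/-- The member of a family at a given parameter. -/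
def toSchwartz (hf : IsSchwartzFamily f) (w : A) : 𝓢(V, ℂ) where
  toFun x := f (w, x)
  smooth' := hf.contDiff.comp (contDiff_prodMk_right w)
  decay' k n := by
    obtain ⟨C, N, -, h⟩ := hf.bound k n
    refine ⟨C * (1 + ‖w‖) ^ N, fun x => ?_⟩
    rw [iteratedFDeriv_slice hf.contDiff]
    refine le_trans ?_ (h w x)
    gcongr
    exact norm_compContinuousLinearMap_inr_le _

theorem seminorm_le (hf : IsSchwartzFamily f) (k n : ℕ) : ∃ (C : ℝ) (N : ℕ), 0 ≤ C ∧ ∀ w,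
    SchwartzMap.seminorm ℝ k n (hf.toSchwartz w) ≤ C * (1 + ‖w‖) ^ N := by
  obtain ⟨C, N, hC, h⟩ := hf.bound k n
  refine ⟨C, N, hC, fun w => SchwartzMap.seminorm_le_bound ℝ k n _ (by positivity) fun x => ?_⟩
  refine le_trans ?_ (h w x)
  have := iteratedFDeriv_slice hf.contDiff w x n
  gcongr
  refine le_trans (le_of_eq (congrArg _ this)) (norm_compContinuousLinearMap_inr_le _)

/-- Mean value inequality in the parameter: the derivative in `w` of the n-th derivative is
controlled by the derivative of order n + 1, whose weighted bound is uniform in `x` and locally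
uniform in `w`. -/
theorem continuous (hf : IsSchwartzFamily f) : Continuous hf.toSchwartz := by
  refine continuous_iff_continuousAt.2 fun w₀ => ?_
  refine ((schwartz_withSeminorms ℝ V ℂ).tendsto_nhds _ _).2 fun ⟨k, n⟩ ε hε => ?_
  obtain ⟨C, N, hC, h⟩ := hf.bound k (n + 1)
  -- On the unit ball around `w₀` one has 1 + ‖w‖ ≤ 2 + ‖w₀‖.
  set D := C * (2 + ‖w₀‖) ^ N
  have hD : 0 ≤ D := by positivity
  have key (w : A) (hw : w ∈ Metric.ball w₀ 1) :
      SchwartzMap.seminorm ℝ k n (hf.toSchwartz w - hf.toSchwartz w₀) ≤ D * ‖w - w₀‖ := by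
    refine SchwartzMap.seminorm_le_bound ℝ k n _ (by positivity) fun x => ?_
    rcases (by positivity : 0 ≤ ‖x‖ ^ k).eq_or_lt with hx | hx
    · rw [← hx, zero_mul]; positivity
    have hd (w : A) : HasFDerivAt (fun w => iteratedFDeriv ℝ n f (w, x))
        ((fderiv ℝ (iteratedFDeriv ℝ n f) (w, x)).comp (ContinuousLinearMap.inl ℝ A V)) w := by
      have h1 : HasFDerivAt (iteratedFDeriv ℝ n f) (fderiv ℝ (iteratedFDeriv ℝ n f) (w, x))
          (w, x) := ((hf.contDiff.of_le (m := (n + 1 : ℕ))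
            (mod_cast le_top)).differentiable_iteratedFDeriv
          (by exact_mod_cast Nat.lt_succ_self n) (w, x)).hasFDerivAt
      exact h1.comp w (hasFDerivAt_prodMk_left w x)
    have hb (w : A) (hw : w ∈ Metric.ball w₀ 1) :
        ‖(fderiv ℝ (iteratedFDeriv ℝ n f) (w, x)).comp (ContinuousLinearMap.inl ℝ A V)‖ ≤
          D / ‖x‖ ^ k := by
      have h1 : ‖(fderiv ℝ (iteratedFDeriv ℝ n f) (w, x)).comp (ContinuousLinearMap.inl ℝ A V)‖ ≤
          ‖iteratedFDeriv ℝ (n + 1) f (w, x)‖ := by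
        rw [← norm_fderiv_iteratedFDeriv]
        refine (ContinuousLinearMap.opNorm_comp_le _ _).trans ?_
        exact mul_le_of_le_one_right (norm_nonneg _) (ContinuousLinearMap.norm_inl_le_one ..)
      rw [le_div_iff₀' hx]
      refine (mul_le_mul_of_nonneg_left h1 (by positivity)).trans ((h w x).trans ?_)
      have h1 : ‖w - w₀‖ < 1 := mem_ball_iff_norm.1 hw
      have h2 := norm_add_le (w - w₀) w₀
      rw [sub_add_cancel] at h2
      have h3 : 1 + ‖w‖ ≤ 2 + ‖w₀‖ := by linarith
      simp only [D]
      gcongr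
    have hmv := (convex_ball w₀ 1).norm_image_sub_le_of_norm_hasFDerivWithin_le
      (fun w hw => (hd w).hasFDerivWithinAt) hb (Metric.mem_ball_self one_pos) hw
    rw [div_mul_eq_mul_div, le_div_iff₀' hx] at hmv
    refine le_trans ?_ hmv
    gcongr
    have e : iteratedFDeriv ℝ n (hf.toSchwartz w - hf.toSchwartz w₀ : 𝓢(V, ℂ)) x =
        (iteratedFDeriv ℝ n f (w, x) - iteratedFDeriv ℝ n f (w₀, x)).compContinuousLinearMap
          fun _ => ContinuousLinearMap.inr ℝ A V := by
      have h1 := iteratedFDeriv_sub_apply ((hf.toSchwartz w).smooth n).contDiffAt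
        ((hf.toSchwartz w₀).smooth n).contDiffAt (x := x)
      have h2 := iteratedFDeriv_slice hf.contDiff w x n
      have h3 := iteratedFDeriv_slice hf.contDiff w₀ x n
      refine h1.trans ((congrArg₂ _ h2 h3).trans ?_)
      ext v; simp
    rw [e]
    exact norm_compContinuousLinearMap_inr_le _
  have hlim : Tendsto (fun w => D * ‖w - w₀‖) (𝓝 w₀) (𝓝 0) := by
    have : Continuous fun w => D * ‖w - w₀‖ := by fun_prop
    simpa using this.tendsto w₀
  filter_upwards [hlim.eventually_lt_const hε, Metric.ball_mem_nhds w₀ one_pos] with w h1 h2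
  exact (key w h2).trans_lt h1

end IsSchwartzFamily

theorem isSchwartzFamily_schwartz (g : 𝓢(A × V, ℂ)) : IsSchwartzFamily g where
  contDiff := g.smooth'
  bound k n := by
    refine ⟨SchwartzMap.seminorm ℝ k n g, 0, by positivity, fun w x => ?_⟩
    rw [pow_zero, mul_one]
    refine le_trans ?_ (g.le_seminorm ℝ k n (w, x))
    gcongr
    exact norm_snd_le (w, x)

/-- The sum of the Schwartz seminorms up to the orders `k` and `n`. -/
noncomputable def seminormSum (k n : ℕ) : Seminorm ℝ 𝓢(V, ℂ) :=
  ∑ m ∈ Finset.range (k + 1) ×ˢ Finset.range (n + 1), SchwartzMap.seminorm ℝ m.1 m.2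

theorem seminormSum_apply (k n : ℕ) (f : 𝓢(V, ℂ)) : seminormSum k n f =
    ∑ m ∈ Finset.range (k + 1) ×ˢ Finset.range (n + 1), SchwartzMap.seminorm ℝ m.1 m.2 f := by
  simp [seminormSum]

theorem seminorm_le_seminormSum {k n j i : ℕ} (hj : j ≤ k) (hi : i ≤ n) (f : 𝓢(V, ℂ)) :
    SchwartzMap.seminorm ℝ j i f ≤ seminormSum k n f := by
  rw [seminormSum_apply]
  exact Finset.single_le_sum (f := fun m : ℕ × ℕ => SchwartzMap.seminorm ℝ m.1 m.2 f)
    (fun m _ => by positivity) (a := (j, i))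
    (by simp [Nat.lt_succ_of_le hj, Nat.lt_succ_of_le hi])

theorem continuous_seminormSum (k n : ℕ) : Continuous (seminormSum k n : Seminorm ℝ 𝓢(V, ℂ)) := by
  have : ⇑(seminormSum k n : Seminorm ℝ 𝓢(V, ℂ)) = fun f =>
    ∑ m ∈ Finset.range (k + 1) ×ˢ Finset.range (n + 1), SchwartzMap.seminorm ℝ m.1 m.2 f :=
    funext fun f => seminormSum_apply k n f
  rw [this]
  exact continuous_finsetSum _ fun m _ =>
    (schwartz_withSeminorms ℝ V ℂ).continuous_seminorm (m.1, m.2)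

theorem exists_norm_le_seminormSum {H : Type*} [NormedAddCommGroup H] [NormedSpace ℝ H]
    (T : 𝓢(V, ℂ) →L[ℝ] H) : ∃ (k n : ℕ) (C : ℝ), 0 ≤ C ∧ ∀ f, ‖T f‖ ≤ C * seminormSum k n f := by
  obtain ⟨s, C, hC, h⟩ := exists_norm_le_sum_seminorm T
  refine ⟨s.sup Prod.fst, s.sup Prod.snd, C * s.card, by positivity, fun f => (h f).trans ?_⟩
  rw [mul_assoc]
  gcongr
  rw [← nsmul_eq_mul]
  exact Finset.sum_le_card_nsmul _ _ _ fun m hm =>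
    seminorm_le_seminormSum (Finset.le_sup (f := Prod.fst) hm) (Finset.le_sup (f := Prod.snd) hm) f

/-- Leibniz's rule. The binomial coefficients sum to 2ⁿ, and a further factor 2 comes from ‖z‖^k ≤
‖z.1‖^k + ‖z.2‖^k. -/
theorem seminorm_tensor_le (k n : ℕ) (f : 𝓢(V, ℂ)) (g : 𝓢(W, ℂ)) :
    SchwartzMap.seminorm ℝ k n (tensor f g) ≤
      2 ^ (n + 1) * (seminormSum k n f * seminormSum k n g) := by
  refine SchwartzMap.seminorm_le_bound ℝ k n _ (by positivity) fun z => ?_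
  have h := norm_iteratedFDeriv_mul_le (𝕜 := ℝ) (N := n)
    (f := fun z : V × W => f z.1) (g := fun z : V × W => g z.2)
    ((f.smooth n).comp contDiff_fst) ((g.smooth n).comp contDiff_snd) z le_rfl
  refine (mul_le_mul_of_nonneg_left h (by positivity)).trans ?_
  have e : (2 : ℝ) ^ (n + 1) * (seminormSum k n f * seminormSum k n g) =
      ∑ i ∈ Finset.range (n + 1), (n.choose i : ℝ) *
        (2 * (seminormSum k n f * seminormSum k n g)) := by
    rw [← Finset.sum_mul, ← Nat.cast_sum, Nat.sum_range_choose]; push_cast; ring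
  rw [Finset.mul_sum, e]
  refine Finset.sum_le_sum fun i hi => ?_
  have hi : i ≤ n := Nat.lt_succ_iff.1 (Finset.mem_range.1 hi)
  have h1 : ‖iteratedFDeriv ℝ i (fun z : V × W => f z.1) z‖ ≤ ‖iteratedFDeriv ℝ i f z.1‖ :=
    norm_iteratedFDeriv_comp_le_of_norm_le_one (ContinuousLinearMap.fst ℝ V W)
      (ContinuousLinearMap.norm_fst_le ..) f z i
  have h2 : ‖iteratedFDeriv ℝ (n - i) (fun z : V × W => g z.2) z‖ ≤
      ‖iteratedFDeriv ℝ (n - i) g z.2‖ :=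
    norm_iteratedFDeriv_comp_le_of_norm_le_one (ContinuousLinearMap.snd ℝ V W)
      (ContinuousLinearMap.norm_snd_le ..) g z (n - i)
  have f1 := (f.le_seminorm ℝ k i z.1).trans (seminorm_le_seminormSum le_rfl hi f)
  have f0 := (f.norm_iteratedFDeriv_le_seminorm ℝ i z.1).trans
    (seminorm_le_seminormSum (Nat.zero_le k) hi f)
  have g1 := (g.le_seminorm ℝ k (n - i) z.2).trans
    (seminorm_le_seminormSum le_rfl (Nat.sub_le n i) g)
  have g0 := (g.norm_iteratedFDeriv_le_seminorm ℝ (n - i) z.2).trans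
    (seminorm_le_seminormSum (Nat.zero_le k) (Nat.sub_le n i) g)
  calc ‖z‖ ^ k * ((n.choose i : ℝ) * ‖iteratedFDeriv ℝ i (fun z : V × W => f z.1) z‖ *
        ‖iteratedFDeriv ℝ (n - i) (fun z : V × W => g z.2) z‖)
      ≤ (‖z.1‖ ^ k + ‖z.2‖ ^ k) * ((n.choose i : ℝ) * ‖iteratedFDeriv ℝ i f z.1‖ *
        ‖iteratedFDeriv ℝ (n - i) g z.2‖) := by
        gcongr; exact norm_pow_le_add z k
    _ = (n.choose i : ℝ) * ((‖z.1‖ ^ k * ‖iteratedFDeriv ℝ i f z.1‖) *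
        ‖iteratedFDeriv ℝ (n - i) g z.2‖ + ‖iteratedFDeriv ℝ i f z.1‖ *
        (‖z.2‖ ^ k * ‖iteratedFDeriv ℝ (n - i) g z.2‖)) := by ring
    _ ≤ (n.choose i : ℝ) * (seminormSum k n f * seminormSum k n g +
        seminormSum k n f * seminormSum k n g) := by gcongr
    _ = _ := by ring

theorem tensor_sub_left (f f' : 𝓢(V, ℂ)) (g : 𝓢(W, ℂ)) :
    tensor (f - f') g = tensor f g - tensor f' g := by
  ext z; simp [tensor_apply, sub_mul]

theorem tensor_sub_right (f : 𝓢(V, ℂ)) (g g' : 𝓢(W, ℂ)) :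
    tensor f (g - g') = tensor f g - tensor f g' := by
  ext z; simp [tensor_apply, mul_sub]

/-- Joint continuity from b(f, g) - b(f₀, g₀) = b(f - f₀, g) + b(f₀, g - g₀). Measuring with a
single seminorm lets the argument serve both the tensor product, one Schwartz seminorm at a time,
and forms with values in a normed space. -/
theorem tendsto_bilinear {M B : Type*} [TopologicalSpace B] [AddCommGroup M] [Module ℝ M]
    (r : Seminorm ℝ M) (b : 𝓢(V, ℂ) → 𝓢(W, ℂ) → M) (h₁ : ∀ f f' g, b (f - f') g = b f g - b f' g)
    (h₂ : ∀ f g g', b f (g - g') = b f g - b f g') (k n k' n' : ℕ) (C : ℝ)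
    (hb : ∀ f g, r (b f g) ≤ C * (seminormSum k n f * seminormSum k' n' g))
    {F : B → 𝓢(V, ℂ)} {G : B → 𝓢(W, ℂ)} (hF : Continuous F) (hG : Continuous G) (w₀ : B) :
    Tendsto (fun w => r (b (F w) (G w) - b (F w₀) (G w₀))) (𝓝 w₀) (𝓝 0) := by
  have hp := continuous_seminormSum (V := V) k n
  have hq := continuous_seminormSum (V := W) k' n'
  have hlim : Tendsto (fun w => C * (seminormSum k n (F w - F w₀) * seminormSum k' n' (G w)) +
      C * (seminormSum k n (F w₀) * seminormSum k' n' (G w - G w₀))) (𝓝 w₀) (𝓝 0) := by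
    have : Continuous fun w => C * (seminormSum k n (F w - F w₀) * seminormSum k' n' (G w)) +
      C * (seminormSum k n (F w₀) * seminormSum k' n' (G w - G w₀)) := by fun_prop
    simpa using this.tendsto w₀
  refine squeeze_zero (fun w => by positivity) (fun w => ?_) hlim
  have e : b (F w) (G w) - b (F w₀) (G w₀) = b (F w - F w₀) (G w) + b (F w₀) (G w - G w₀) := by
    rw [h₁, h₂]; abel
  rw [e]
  exact (map_add_le_add r _ _).trans (add_le_add (hb _ _) (hb _ _))

theorem continuous_tensor {B : Type*} [TopologicalSpace B] {F : B → 𝓢(V, ℂ)} {G : B → 𝓢(W, ℂ)}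
    (hF : Continuous F) (hG : Continuous G) : Continuous fun w => tensor (F w) (G w) := by
  refine continuous_iff_continuousAt.2 fun w₀ => ?_
  refine ((schwartz_withSeminorms ℝ (V × W) ℂ).tendsto_nhds _ _).2 fun ⟨k, n⟩ ε hε => ?_
  exact (tendsto_bilinear (SchwartzMap.seminorm ℝ k n) tensor tensor_sub_left tensor_sub_right
    k n k n _ (seminorm_tensor_le k n) hF hG w₀).eventually_lt_const hε

/-- Tensor product with a fixed Schwartz function as a continuous operator. -/
noncomputable def tensorRight (g : 𝓢(W, ℂ)) : 𝓢(V, ℂ) →L[ℂ] 𝓢(V × W, ℂ) where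
  toFun f := tensor f g
  map_add' f f' := by ext z; simp [tensor_apply, add_mul]
  map_smul' c f := by ext z; simp [tensor_apply, mul_assoc]
  cont := continuous_tensor continuous_id continuous_const

end Slices

/-! ### Time-frequency atoms, growth and decay bounds, Fourier inversion -/

section Gabor

open scoped ContDiff

variable {V W : Type} [NormedAddCommGroup V] [InnerProductSpace ℝ V] [FiniteDimensional ℝ V]
  [MeasurableSpace V] [BorelSpace V] [NormedAddCommGroup W] [InnerProductSpace ℝ W]
  [FiniteDimensional ℝ W] [MeasurableSpace W] [BorelSpace W]

theorem exists_schwartz_bump (V : Type) [NormedAddCommGroup V] [InnerProductSpace ℝ V]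
    [FiniteDimensional ℝ V] : ∃ f : V → ℝ, ContDiff ℝ ∞ f ∧ HasCompactSupport f ∧ f 0 = 1 := by
  let b : ContDiffBump (0 : V) := ⟨1, 2, one_pos, one_lt_two⟩
  exact ⟨b, b.contDiff, b.hasCompactSupport,
    b.one_of_mem_closedBall (Metric.mem_closedBall_self zero_le_one)⟩

theorem exists_schwartz_eq_one (V : Type) [NormedAddCommGroup V] [InnerProductSpace ℝ V]
    [FiniteDimensional ℝ V] : ∃ g : 𝓢(V, ℂ), g 0 = 1 := by
  obtain ⟨f, hf, hc, h0⟩ := exists_schwartz_bump V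
  have hc' : HasCompactSupport fun x => (f x : ℂ) := hc.comp_left Complex.ofReal_zero
  refine ⟨hc'.toSchwartzMap (Complex.ofRealCLM.contDiff.comp hf), ?_⟩
  change (f 0 : ℂ) = 1
  rw [h0, Complex.ofReal_one]

theorem exists_window (V : Type) [NormedAddCommGroup V] [InnerProductSpace ℝ V]
    [FiniteDimensional ℝ V] [MeasurableSpace V] [BorelSpace V] :
    ∃ χ : 𝓢(V, ℂ), HasCompactSupport χ ∧ ∫ x, χ x * χ x = 1 := by
  obtain ⟨f, hf, hc, h0⟩ := exists_schwartz_bump V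
  have hpos : 0 < ∫ x, f x * f x := by
    refine Continuous.integral_pos_of_hasCompactSupport_nonneg_nonzero
      (hf.continuous.mul hf.continuous)
      hc.mul_left (fun x => mul_self_nonneg _) (x := 0) (by simp [h0])
  set c := ∫ x, f x * f x with hcdef
  have hc' : HasCompactSupport fun x => (((Real.sqrt c)⁻¹ * f x : ℝ) : ℂ) :=
    (hc.mul_left (f := fun _ => (Real.sqrt c)⁻¹)).comp_left Complex.ofReal_zero
  refine ⟨hc'.toSchwartzMap (Complex.ofRealCLM.contDiff.comp (contDiff_const.mul hf)), hc', ?_⟩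
  change ∫ x, (((Real.sqrt c)⁻¹ * f x : ℝ) : ℂ) * (((Real.sqrt c)⁻¹ * f x : ℝ) : ℂ) = 1
  have e (x : V) : (((Real.sqrt c)⁻¹ * f x : ℝ) : ℂ) * (((Real.sqrt c)⁻¹ * f x : ℝ) : ℂ) =
      ((c⁻¹ * (f x * f x) : ℝ) : ℂ) := by
    rw [← Complex.ofReal_mul]
    congr 1
    have : (Real.sqrt c)⁻¹ * (Real.sqrt c)⁻¹ = c⁻¹ := by
      rw [← mul_inv, Real.mul_self_sqrt hpos.le]
    rw [← this]; ring
  simp only [e]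
  rw [integral_complex_ofReal, integral_const_mul, ← hcdef, inv_mul_cancel₀ hpos.ne',
    Complex.ofReal_one]

/-- A compactly supported smooth function with `∫ χ² = 1`. -/
noncomputable def window (V : Type) [NormedAddCommGroup V] [InnerProductSpace ℝ V]
    [FiniteDimensional ℝ V] [MeasurableSpace V] [BorelSpace V] : 𝓢(V, ℂ) :=
  (exists_window V).choose

theorem window_hasCompactSupport : HasCompactSupport (window V) := (exists_window V).choose_spec.1

theorem integral_window : ∫ x, window V x * window V x = 1 := (exists_window V).choose_spec.2

/-- The time-frequency shifts `exp(-i⟨x, ξ⟩) χ(x - y)` of the window as a function of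
`((y, ξ), x)`. -/
noncomputable def atomFun (V : Type) [NormedAddCommGroup V] [InnerProductSpace ℝ V]
    [FiniteDimensional ℝ V] [MeasurableSpace V] [BorelSpace V] (p : (V × V) × V) : ℂ :=
  Complex.exp (Complex.I * (-inner ℝ p.2 p.1.2 : ℝ)) * window V (p.2 - p.1.1)

theorem hasTemperateGrowth_atomFun : Function.HasTemperateGrowth (atomFun V) := by
  have h1 : Function.HasTemperateGrowth fun p : (V × V) × V => -inner ℝ p.2 p.1.2 := by
    refine Function.HasTemperateGrowth.fun_neg ?_
    exact (innerSL ℝ (E := V)).bilinear_hasTemperateGrowth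
      (ContinuousLinearMap.snd ℝ (V × V) V).hasTemperateGrowth
      ((ContinuousLinearMap.snd ℝ V V).comp (ContinuousLinearMap.fst ℝ (V × V) V)).hasTemperateGrowth
  have h2 : Function.HasTemperateGrowth fun p : (V × V) × V => p.2 - p.1.1 :=
    (ContinuousLinearMap.snd ℝ (V × V) V -
      (ContinuousLinearMap.fst ℝ V V).comp (ContinuousLinearMap.fst ℝ (V × V) V)).hasTemperateGrowth
  exact (hasTemperateGrowth_expI.comp h1).mul ((window V).hasTemperateGrowth.comp h2)

/-- Temperate growth bounds the derivatives by a power of 1 + ‖(w, x)‖. Where they do not vanish, x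
lies within a fixed distance of the center y of the window, so all powers of ‖x‖ are traded for
powers of 1 + ‖w‖. -/
theorem isSchwartzFamily_atomFun : IsSchwartzFamily (atomFun V) where
  contDiff := hasTemperateGrowth_atomFun.1
  bound k n := by
    obtain ⟨N, C, hC, h⟩ := hasTemperateGrowth_atomFun (V := V).norm_iteratedFDeriv_le_uniform n
    obtain ⟨R, hR, hsupp⟩ : ∃ R : ℝ, 0 ≤ R ∧ ∀ x ∈ tsupport (window V), ‖x‖ ≤ R := by
      obtain ⟨R, hR⟩ := (window_hasCompactSupport (V := V)).isCompact.isBounded.exists_norm_le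
      exact ⟨max R 0, le_max_right _ _, fun x hx => (hR x hx).trans (le_max_left _ _)⟩
    refine ⟨(R + 1) ^ k * (C * (R + 2) ^ N), k + N, by positivity, fun w x => ?_⟩
    by_cases h0 : iteratedFDeriv ℝ n (atomFun V) (w, x) = 0
    · rw [h0, norm_zero, mul_zero]; positivity
    have hmem : x - w.1 ∈ tsupport (window V) := by
      have hcl : IsClosed ((fun p : (V × V) × V => p.2 - p.1.1) ⁻¹' tsupport (window V)) :=
        (isClosed_tsupport _).preimage (by fun_prop)
      have hsub : tsupport (atomFun V) ⊆
          (fun p : (V × V) × V => p.2 - p.1.1) ⁻¹' tsupport (window V) := by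
        refine closure_minimal (fun p hp => ?_) hcl
        exact subset_tsupport _ (right_ne_zero_of_mul hp)
      exact hsub (support_iteratedFDeriv_subset n h0)
    have hx : ‖x‖ ≤ R + ‖w‖ := by
      have h1 := norm_add_le (x - w.1) w.1
      rw [sub_add_cancel] at h1
      linarith [hsupp _ hmem, norm_fst_le w]
    have hx' : ‖x‖ ≤ (R + 1) * (1 + ‖w‖) := by nlinarith [norm_nonneg w]
    have hz : 1 + ‖(w, x)‖ ≤ (R + 2) * (1 + ‖w‖) := by
      have : ‖(w, x)‖ ≤ R + ‖w‖ := max_le (by linarith) hx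
      nlinarith [norm_nonneg w]
    calc ‖x‖ ^ k * ‖iteratedFDeriv ℝ n (atomFun V) (w, x)‖
        ≤ ((R + 1) * (1 + ‖w‖)) ^ k * (C * ((R + 2) * (1 + ‖w‖)) ^ N) := by
          gcongr
          exact (h n le_rfl _).trans (by gcongr)
      _ = _ := by rw [mul_pow, mul_pow, pow_add]; ring

/-- The time-frequency shift of the window by `w = (y, ξ)`. -/
noncomputable def atom (w : V × V) : 𝓢(V, ℂ) := isSchwartzFamily_atomFun.toSchwartz w

theorem atom_apply (w : V × V) (x : V) : atom w x =
    Complex.exp (Complex.I * (-inner ℝ x w.2 : ℝ)) * window V (x - w.1) := rfl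

theorem continuous_atom : Continuous (atom : V × V → 𝓢(V, ℂ)) :=
  isSchwartzFamily_atomFun.continuous

theorem hasCompactSupport_atom (w : V × V) : HasCompactSupport (atom w) := by
  have h1 : HasCompactSupport fun x => window V (x - w.1) :=
    (window_hasCompactSupport (V := V)).comp_homeomorph (Homeomorph.subRight w.1)
  exact h1.mul_left

theorem continuous_slice {A : Type} [NormedAddCommGroup A] [NormedSpace ℝ A] (g : 𝓢(A × W, ℂ)) :
    Continuous (slice g) :=
  (isSchwartzFamily_schwartz g).continuous

/-- Slices decay faster than any power of the parameter, at the price of a higher weight in the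
seminorm of `g`. The factor (k + 1)(n + 1) counts the seminorms in the sum. -/
theorem pow_mul_seminormSum_slice_le {A : Type} [NormedAddCommGroup A] [NormedSpace ℝ A]
    (M k n : ℕ) (g : 𝓢(A × W, ℂ)) (w : A) : (1 + ‖w‖) ^ M * seminormSum k n (slice g w) ≤
      ((k + 1) * (n + 1) : ℕ) * (2 ^ M * 2 * seminormSum (M + k) n g) := by
  rw [seminormSum_apply k n, Finset.mul_sum, ← nsmul_eq_mul]
  refine (Finset.sum_le_card_nsmul _ _ (2 ^ M * 2 * seminormSum (M + k) n g)
    fun m hm => ?_).trans (le_of_eq (by simp))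
  simp only [Finset.mem_product, Finset.mem_range] at hm
  have h1 : (1 + ‖w‖) ^ M ≤ 2 ^ M * (1 + ‖w‖ ^ M) := by
    have := add_pow_le zero_le_one (norm_nonneg w) M
    rw [one_pow] at this
    refine this.trans ?_
    gcongr
    · norm_num
    · exact Nat.sub_le _ _
  have h2 := slice_seminorm g w 0 m.1 m.2
  have h3 := slice_seminorm g w M m.1 m.2
  rw [pow_zero, one_mul, zero_add] at h2
  have h2' : SchwartzMap.seminorm ℝ m.1 m.2 (slice g w) ≤ seminormSum (M + k) n g :=
    LE.le.trans h2 (seminorm_le_seminormSum (by omega) (by omega) g)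
  have h3' : ‖w‖ ^ M * SchwartzMap.seminorm ℝ m.1 m.2 (slice g w) ≤ seminormSum (M + k) n g :=
    LE.le.trans h3 (seminorm_le_seminormSum (by omega) (by omega) g)
  calc (1 + ‖w‖) ^ M * SchwartzMap.seminorm ℝ m.1 m.2 (slice g w)
      ≤ 2 ^ M * (1 + ‖w‖ ^ M) * SchwartzMap.seminorm ℝ m.1 m.2 (slice g w) := by gcongr
    _ = 2 ^ M * (SchwartzMap.seminorm ℝ m.1 m.2 (slice g w) +
        ‖w‖ ^ M * SchwartzMap.seminorm ℝ m.1 m.2 (slice g w)) := by ring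
    _ ≤ 2 ^ M * (seminormSum (M + k) n g + seminormSum (M + k) n g) := by gcongr
    _ = _ := by ring

/-- The integrable weight `(1 + ‖w‖) ^ (-r)` with `r = dim (V × V) + 1`. -/
noncomputable def decayWeight (w : V × V) : ℝ := ((1 + ‖w‖) ^ (Module.finrank ℝ (V × V) + 1))⁻¹

theorem integrable_decayWeight : Integrable (decayWeight (V := V)) := by
  have : (volume : Measure (V × V)).IsAddHaarMeasure :=
    inferInstanceAs ((volume : Measure V).prod (volume : Measure V)).IsAddHaarMeasure
  have h := integrable_one_add_norm (E := V × V) (μ := volume)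
    (r := (Module.finrank ℝ (V × V) + 1 : ℕ)) (by push_cast; linarith)
  refine h.congr (.of_forall fun w => ?_)
  simp only [decayWeight]
  rw [Real.rpow_neg (by positivity), Real.rpow_natCast]

/-- The decay of the slices beats the polynomial growth of the atoms and leaves an integrable
weight. The constant and the order do not depend on `g`, so the bound is a continuous seminorm of
`g`. -/
theorem exists_atom_mul_slice_le (k n k' n' : ℕ) : ∃ (C : ℝ) (M : ℕ), 0 ≤ C ∧
    ∀ (g : 𝓢((V × V) × W, ℂ)) (w : V × V),
      seminormSum k n (atom w) * seminormSum k' n' (slice g w) ≤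
        C * seminormSum M n' g * decayWeight w := by
  choose C N hC h using (isSchwartzFamily_atomFun (V := V)).seminorm_le
  let S := Finset.range (k + 1) ×ˢ Finset.range (n + 1)
  let N₀ := S.sup fun m => N m.1 m.2
  have hat (w : V × V) : seminormSum k n (atom w) ≤ (∑ m ∈ S, C m.1 m.2) * (1 + ‖w‖) ^ N₀ := by
    rw [seminormSum_apply, Finset.sum_mul]
    refine Finset.sum_le_sum fun m hm => (h m.1 m.2 w).trans ?_
    have := hC m.1 m.2
    gcongr
    · linarith [norm_nonneg w]
    · exact Finset.le_sup (f := fun m : ℕ × ℕ => N m.1 m.2) hm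
  let R := Module.finrank ℝ (V × V) + 1
  have hS : 0 ≤ ∑ m ∈ S, C m.1 m.2 := Finset.sum_nonneg fun m _ => hC _ _
  refine ⟨(∑ m ∈ S, C m.1 m.2) * (((k' + 1) * (n' + 1) : ℕ) * (2 ^ (N₀ + R) * 2)),
    (N₀ + R) + k', by positivity, fun g w => ?_⟩
  have h2 := pow_mul_seminormSum_slice_le (N₀ + R) k' n' g w
  rw [decayWeight, ← div_eq_mul_inv, le_div_iff₀ (by positivity)]
  calc seminormSum k n (atom w) * seminormSum k' n' (slice g w) * (1 + ‖w‖) ^ R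
      ≤ (∑ m ∈ S, C m.1 m.2) * (1 + ‖w‖) ^ N₀ * seminormSum k' n' (slice g w) *
        (1 + ‖w‖) ^ R := by gcongr; exact hat w
    _ = (∑ m ∈ S, C m.1 m.2) * ((1 + ‖w‖) ^ (N₀ + R) * seminormSum k' n' (slice g w)) := by ring
    _ ≤ (∑ m ∈ S, C m.1 m.2) * (((k' + 1) * (n' + 1) : ℕ) *
        (2 ^ (N₀ + R) * 2 * seminormSum (N₀ + R + k') n' g)) := by gcongr
    _ = _ := by ring

/-- The constant in the inversion formula of the partial Fourier transform. -/
noncomputable def fourierConst (V : Type) [NormedAddCommGroup V] [InnerProductSpace ℝ V] : ℝ :=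
  (2 * Real.pi) ^ (-(Module.finrank ℝ V : ℝ) / 2) * |((2 * Real.pi)⁻¹ ^ Module.finrank ℝ V)⁻¹|

theorem fourierConst_ne_zero : fourierConst V ≠ 0 := by
  unfold fourierConst
  positivity

/-- Fourier inversion in the second variable. The substitution ξ = 2πη passes to the transform with
2π in the exponent; its Jacobian and the factor (2π)^(-dim V / 2) make up `fourierConst`. -/
theorem integral_exp_mul_partialFourierInv {E : Type} [NormedAddCommGroup E] [NormedSpace ℝ E]
    (f : 𝓢(E × V, ℂ)) (z : E) (x : V) :
    ∫ ξ, Complex.exp (Complex.I * (-inner ℝ x ξ : ℝ)) * partialFourierInv f (z, ξ) =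
      fourierConst V * f (z, x) := by
  have h1 (ξ : V) : Complex.exp (Complex.I * (-inner ℝ x ξ : ℝ)) * partialFourierInv f (z, ξ) =
      (((2 * Real.pi) ^ (-(Module.finrank ℝ V : ℝ) / 2) : ℝ) : ℂ) *
        (fun η : V => Complex.exp (((-2 * Real.pi * inner ℝ η x : ℝ) : ℂ) * Complex.I) •
          𝓕⁻ (slice f z) η) ((2 * Real.pi)⁻¹ • ξ) := by
    have e : partialFourierInv f (z, ξ) =
      (((2 * Real.pi) ^ (-(Module.finrank ℝ V : ℝ) / 2) : ℝ) : ℂ) *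
        partialFourierIntegral f (z, ξ) := rfl
    rw [e, partialFourierIntegral_eq]
    dsimp only
    rw [inner_smul_left, real_inner_comm x ξ, smul_eq_mul, mul_left_comm]
    congr 3
    have hpi : (2 * Real.pi : ℝ) ≠ 0 := by positivity
    have : -2 * Real.pi * ((starRingEnd ℝ) (2 * Real.pi)⁻¹ * inner ℝ x ξ) = -inner ℝ x ξ := by
      rw [conj_trivial]; field_simp
    rw [this, mul_comm]
  simp only [h1]
  rw [integral_const_mul, Measure.integral_comp_smul volume
    (fun η : V => Complex.exp (((-2 * Real.pi * inner ℝ η x : ℝ) : ℂ) * Complex.I) •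
          𝓕⁻ (slice f z) η), ← Real.fourier_eq', ← SchwartzMap.fourier_coe]
  rw [FourierTransform.fourier_fourierInv_eq, slice_apply, fourierConst]
  rw [Complex.real_smul]
  push_cast
  ring

end Gabor

/-! ### Expansion of Schwartz functions in atoms -/

section Expansion

variable {V W : Type} [NormedAddCommGroup V] [InnerProductSpace ℝ V] [FiniteDimensional ℝ V]
  [MeasurableSpace V] [BorelSpace V] [NormedAddCommGroup W] [InnerProductSpace ℝ W]
  [FiniteDimensional ℝ W] [MeasurableSpace W] [BorelSpace W]

/-- The linear map `((y, y'), x) ↦ ((x, y'), x - y)`. -/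
def windowEquiv (V W : Type) [NormedAddCommGroup V] [NormedSpace ℝ V] [NormedAddCommGroup W]
    [NormedSpace ℝ W] : ((V × W) × V) ≃L[ℝ] ((V × W) × V) where
  toFun p := ((p.2, p.1.2), p.2 - p.1.1)
  invFun q := ((q.1.1 - q.2, q.1.2), q.1.1)
  map_add' p q := by ext <;> simp; abel
  map_smul' c p := by ext <;> simp [smul_sub]
  left_inv p := by ext <;> simp
  right_inv q := by ext <;> simp
  continuous_toFun := by fun_prop
  continuous_invFun := by fun_prop

/-- The linear map `((y, ξ), y') ↦ ((y, y'), ξ)`. -/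
def swapEquiv (V W : Type) [NormedAddCommGroup V] [NormedSpace ℝ V] [NormedAddCommGroup W]
    [NormedSpace ℝ W] : ((V × V) × W) ≃L[ℝ] ((V × W) × V) where
  toFun p := ((p.1.1, p.2), p.1.2)
  invFun q := ((q.1.1, q.2), q.1.2)
  map_add' p q := by ext <;> simp
  map_smul' c p := by ext <;> simp
  left_inv p := rfl
  right_inv q := rfl
  continuous_toFun := by fun_prop
  continuous_invFun := by fun_prop

/-- The function `((y, y'), x) ↦ Φ(x, y') χ(x - y)`. -/
noncomputable def windowed : 𝓢(V × W, ℂ) →L[ℂ] 𝓢((V × W) × V, ℂ) :=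
  (compCLMOfContinuousLinearEquiv ℂ (windowEquiv V W)).comp (tensorRight (window V))

theorem windowed_apply (Φ : 𝓢(V × W, ℂ)) (y : V) (y' : W) (x : V) :
    windowed Φ ((y, y'), x) = Φ (x, y') * window V (x - y) := rfl

/-- The partial short-time Fourier transform in the first variable, as a function of
`((y, ξ), y')`. -/
noncomputable def gabor : 𝓢(V × W, ℂ) →L[ℂ] 𝓢((V × V) × W, ℂ) :=
  ((fourierConst V)⁻¹ : ℂ) •
    ((compCLMOfContinuousLinearEquiv ℂ (swapEquiv V W)).comp partialFourierInv).comp windowed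

theorem gabor_apply (Φ : 𝓢(V × W, ℂ)) (y ξ : V) (y' : W) :
    gabor Φ ((y, ξ), y') =
      ((fourierConst V)⁻¹ : ℂ) * partialFourierInv (windowed Φ) ((y, y'), ξ) := rfl

/-- The coefficient of `φ` at the point `(y, ξ)`. -/
noncomputable def gaborCoeff (φ : 𝓢(V, ℂ)) (w : V × V) : ℂ :=
  ((fourierConst V)⁻¹ : ℂ) * ((((2 * Real.pi) ^ (-(Module.finrank ℝ V : ℝ) / 2) : ℝ) : ℂ) *
    ∫ x, Complex.exp (Complex.I * (inner ℝ w.2 x : ℝ)) * (φ x * window V (x - w.1)))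

/-- The transform acts in the first variable only, so the second factor comes out of the integral.
-/
theorem slice_gabor_tensor (φ : 𝓢(V, ℂ)) (ψ : 𝓢(W, ℂ)) (w : V × V) :
    slice (gabor (tensor φ ψ)) w = gaborCoeff φ w • ψ := by
  ext y'
  rw [slice_apply, smul_apply, smul_eq_mul]
  have h := gabor_apply (tensor φ ψ) w.1 w.2 y'
  refine h.trans ?_
  rw [partialFourierInv_apply, gaborCoeff, mul_assoc, mul_assoc, ← integral_mul_const]
  congr 2
  refine integral_congr_ae (.of_forall fun x => ?_)
  simp only [windowed_apply, tensor_apply]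
  ring

theorem integrable_seminorm_atom_tensor (g : 𝓢((V × V) × W, ℂ)) (k n : ℕ) :
    Integrable fun w => SchwartzMap.seminorm ℝ k n (tensor (atom w) (slice g w)) := by
  obtain ⟨C, M, hC, h⟩ := exists_atom_mul_slice_le (V := V) (W := W) k n k n
  refine ((integrable_decayWeight (V := V)).const_mul
    (2 ^ (n + 1) * (C * seminormSum M n g))).mono' ?_ (.of_forall fun w => ?_)
  · exact (((schwartz_withSeminorms ℝ (V × W) ℂ).continuous_seminorm (k, n)).comp
      (continuous_tensor continuous_atom (continuous_slice g))).aestronglyMeasurable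
  · rw [Real.norm_of_nonneg (by positivity)]
    exact (seminorm_tensor_le k n _ _).trans
      ((mul_le_mul_of_nonneg_left (h g w) (by positivity)).trans (le_of_eq (by ring)))

/-- Integration over ξ is Fourier inversion and produces Φ(x, y') χ(x - y)²; integration over y then
uses ∫ χ² = 1. -/
theorem eq_integral_atom_mul (Φ : 𝓢(V × W, ℂ)) (z : V × W) :
    Φ z = ∫ w, tensor (atom w) (slice (gabor Φ) w) z := by
  obtain ⟨x, y'⟩ := z
  have hc := continuous_tensor continuous_atom (continuous_slice (gabor Φ))
  have hi : Integrable fun w : V × V => tensor (atom w) (slice (gabor Φ) w) (x, y') :=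
    integrable_comp_schwartz volume _ hc (integrable_seminorm_atom_tensor (gabor Φ))
      ((BoundedContinuousFunction.evalCLM ℝ (x, y')).comp
        (toBoundedContinuousFunctionCLM ℝ (V × W) ℂ))
  have hc0 : (fourierConst V : ℂ) ≠ 0 := Complex.ofReal_ne_zero.2 fourierConst_ne_zero
  rw [Measure.volume_eq_prod] at hi ⊢
  rw [integral_prod _ hi]
  have h1 (y : V) : ∫ ξ, tensor (atom (y, ξ)) (slice (gabor Φ) (y, ξ)) (x, y') =
      Φ (x, y') * (window V (x - y) * window V (x - y)) := by
    have e (ξ : V) : tensor (atom (y, ξ)) (slice (gabor Φ) (y, ξ)) (x, y') =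
        window V (x - y) * (fourierConst V : ℂ)⁻¹ *
          (Complex.exp (Complex.I * (-inner ℝ x ξ : ℝ)) *
            partialFourierInv (windowed Φ) ((y, y'), ξ)) := by
      rw [tensor_apply, atom_apply, slice_apply, gabor_apply]
      ring
    simp only [e]
    rw [integral_const_mul, integral_exp_mul_partialFourierInv, windowed_apply]
    field_simp
  simp only [h1]
  rw [integral_const_mul, integral_sub_left_eq_self (fun t => window V t * window V t) volume x,
    integral_window, mul_one]

/-! ### Density of tensor products and of compactly supported functions -/

section Consequences

variable {H : Type*} [NormedAddCommGroup H] [NormedSpace ℝ H] [CompleteSpace H]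

theorem map_eq_integral_atom (T : 𝓢(V × W, ℂ) →L[ℝ] H) (Φ : 𝓢(V × W, ℂ)) :
    T Φ = ∫ w, T (tensor (atom w) (slice (gabor Φ) w)) :=
  map_integral_schwartz volume _ (continuous_tensor continuous_atom (continuous_slice (gabor Φ)))
    (integrable_seminorm_atom_tensor (gabor Φ)) T Φ (eq_integral_atom_mul Φ)

/-- Tensor products span a dense subspace. -/
theorem eq_zero_of_map_tensor (T : 𝓢(V × W, ℂ) →L[ℝ] H) (hT : ∀ φ ψ, T (tensor φ ψ) = 0)
    (Φ : 𝓢(V × W, ℂ)) : T Φ = 0 := by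
  rw [map_eq_integral_atom]
  simp [hT]

/-- The restriction of a Schwartz function to the first factor. -/
noncomputable def restrictFst : 𝓢(V × W, ℂ) →L[ℝ] 𝓢(V, ℂ) :=
  compCLMOfAntilipschitz ℝ (g := fun x : V => (x, (0 : W))) (K := 1)
    (ContinuousLinearMap.inl ℝ V W).hasTemperateGrowth
    (fun a b => by simp [Prod.edist_eq])

theorem restrictFst_apply (Φ : 𝓢(V × W, ℂ)) (x : V) : restrictFst Φ x = Φ (x, 0) := rfl

/-- The expansion in one variable comes from that in two: φ is the restriction of φ ⊗ g to the first
factor when g(0) = 1. -/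
theorem map_eq_integral_gaborCoeff (T : 𝓢(V, ℂ) →L[ℝ] H) (φ : 𝓢(V, ℂ)) :
    T φ = ∫ w, T (gaborCoeff φ w • atom w) := by
  obtain ⟨g, hg⟩ := exists_schwartz_eq_one V
  have h := map_eq_integral_atom (T.comp (restrictFst (V := V) (W := V))) (tensor φ g)
  have e1 : restrictFst (tensor φ g) = φ := by
    ext x; rw [restrictFst_apply, tensor_apply]; simp [hg]
  have e2 (w : V × V) : restrictFst (tensor (atom w) (slice (gabor (tensor φ g)) w)) =
      gaborCoeff φ w • atom w := by
    ext x
    rw [restrictFst_apply, tensor_apply, slice_gabor_tensor]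
    simp [hg, mul_comm]
  simpa only [ContinuousLinearMap.comp_apply, e1, e2] using h

/-- Compactly supported functions are dense. -/
theorem eq_zero_of_map_hasCompactSupport (T : 𝓢(V, ℂ) →L[ℝ] H)
    (hT : ∀ φ : 𝓢(V, ℂ), HasCompactSupport φ → T φ = 0) (φ : 𝓢(V, ℂ)) : T φ = 0 := by
  rw [map_eq_integral_gaborCoeff]
  have h (w : V × V) : T (gaborCoeff φ w • atom w) = 0 :=
    hT _ ((hasCompactSupport_atom w).smul_left (f := fun _ => gaborCoeff φ w))
  simp [h]

end Consequences

/-! ### The kernel theorem for vector-valued forms -/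

section Kernel

open Filter Topology

variable {H : Type*} [NormedAddCommGroup H] [NormedSpace ℂ H] [NormedSpace ℝ H]
  [IsScalarTower ℝ ℂ H] [CompleteSpace H]

/-- A conjugate linear map bounded by a continuous seminorm is continuous. -/
def antilinearOfBound {E : Type} [NormedAddCommGroup E] [NormedSpace ℝ E]
    (f : 𝓢(E, ℂ) →ₛₗ[starRingEnd ℂ] H) (q : 𝓢(E, ℂ) → ℝ) (hq : Continuous q) (h0 : q 0 = 0)
    (h : ∀ φ, ‖f φ‖ ≤ q φ) : 𝓢(E, ℂ) →L⋆[ℂ] H where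
  toLinearMap := f
  cont := by
    refine continuous_of_continuousAt_zero f ?_
    rw [ContinuousAt, map_zero]
    refine squeeze_zero_norm h ?_
    rw [← h0]; exact hq.tendsto 0

theorem integrable_form_atom_slice (b : 𝓢(V, ℂ) →ₛₗ[starRingEnd ℂ] 𝓢(W, ℂ) →ₛₗ[starRingEnd ℂ] H)
    (k n k' n' : ℕ) (C : ℝ) (hb : ∀ φ ψ, ‖b φ ψ‖ ≤ C * (seminormSum k n φ * seminormSum k' n' ψ))
    (D : ℝ) (g : 𝓢((V × V) × W, ℂ))
    (hD : ∀ w : V × V, ‖b (atom w) (slice g w)‖ ≤ D * decayWeight w) :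
    Integrable fun w : V × V => b (atom w) (slice g w) := by
  have hc : Continuous fun w : V × V => b (atom w) (slice g w) := by
    refine continuous_iff_continuousAt.2 fun w₀ => tendsto_iff_norm_sub_tendsto_zero.2 ?_
    exact tendsto_bilinear (normSeminorm ℝ H) (fun φ ψ => b φ ψ) (fun f f' g => by simp)
      (fun f g g' => by simp) k n k' n' C hb continuous_atom (continuous_slice g) w₀
  exact ((integrable_decayWeight (V := V)).const_mul D).mono' hc.aestronglyMeasurable
    (.of_forall hD)

/-- The kernel theorem: a bounded form, conjugate linear in both variables, extends to the Schwartz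
space of the product. -/
theorem exists_kernel (b : 𝓢(V, ℂ) →ₛₗ[starRingEnd ℂ] 𝓢(W, ℂ) →ₛₗ[starRingEnd ℂ] H)
    (k n k' n' : ℕ) (C : ℝ) (hC : 0 ≤ C)
    (hb : ∀ φ ψ, ‖b φ ψ‖ ≤ C * (seminormSum k n φ * seminormSum k' n' ψ)) :
    ∃ U : 𝓢(V × W, ℂ) →L⋆[ℂ] H, ∀ φ ψ, U (tensor φ ψ) = b φ ψ := by
  obtain ⟨C', M, hC', hM⟩ := exists_atom_mul_slice_le (V := V) (W := W) k n k' n'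
  have hbd (g : 𝓢((V × V) × W, ℂ)) (w : V × V) : ‖b (atom w) (slice g w)‖ ≤
      C * (C' * seminormSum M n' g) * decayWeight w :=
    (hb _ _).trans ((mul_le_mul_of_nonneg_left (hM g w) hC).trans (le_of_eq (by ring)))
  have hi (g : 𝓢((V × V) × W, ℂ)) := integrable_form_atom_slice b k n k' n' C hb _ g (hbd g)
  have hsl_add (g g' : 𝓢((V × V) × W, ℂ)) (w : V × V) :
      slice (g + g') w = slice g w + slice g' w := rfl
  have hsl_smul (c : ℂ) (g : 𝓢((V × V) × W, ℂ)) (w : V × V) :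
      slice (c • g) w = c • slice g w := rfl
  -- The form is applied to the atom and coefficient under the integral in the expansion of Φ.
  let f : 𝓢(V × W, ℂ) →ₛₗ[starRingEnd ℂ] H :=
    { toFun := fun Φ => ∫ w, b (atom w) (slice (gabor Φ) w)
      map_add' := fun Φ Ψ => by
        rw [← integral_add (hi _) (hi _)]
        simp only [map_add, hsl_add]
      map_smul' := fun c Φ => by
        rw [← integral_smul]
        simp only [map_smul, hsl_smul, LinearMap.map_smulₛₗ] }
  let I := ∫ w, decayWeight (V := V) w
  have hf (Φ : 𝓢(V × W, ℂ)) : ‖f Φ‖ ≤ C * (C' * seminormSum M n' (gabor Φ)) * I := by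
    refine (norm_integral_le_of_norm_le ((integrable_decayWeight (V := V)).const_mul _)
      (.of_forall (hbd (gabor Φ)))).trans (le_of_eq ?_)
    rw [integral_const_mul]
  have hq : Continuous fun Φ : 𝓢(V × W, ℂ) => C * (C' * seminormSum M n' (gabor Φ)) * I := by
    have := (continuous_seminormSum M n').comp (gabor (V := V) (W := W)).continuous
    exact (continuous_const.mul (continuous_const.mul this)).mul continuous_const
  refine ⟨antilinearOfBound f _ hq (by simp) hf, fun φ ψ => ?_⟩
  change ∫ w, b (atom w) (slice (gabor (tensor φ ψ)) w) = b φ ψ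
  -- For Φ = φ ⊗ ψ the coefficient at `w` is a scalar times ψ. As `b` is conjugate linear in both
  -- arguments, the scalar may be moved onto the atom, and the integral becomes the expansion of φ
  -- under the continuous map b(·, ψ).
  let T : 𝓢(V, ℂ) →L⋆[ℂ] H := antilinearOfBound (b.flip ψ)
    (fun φ => C * (seminormSum k n φ * seminormSum k' n' ψ))
    (continuous_const.mul ((continuous_seminormSum k n).mul continuous_const)) (by simp)
    (fun φ => hb φ ψ)
  have h := map_eq_integral_gaborCoeff (realCLM T) φ
  refine Eq.trans ?_ h.symm
  refine integral_congr_ae (.of_forall fun w => ?_)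
  change b (atom w) (slice (gabor (tensor φ ψ)) w) = b (gaborCoeff φ w • atom w) ψ
  rw [slice_gabor_tensor, map_smulₛₗ, map_smulₛₗ]
  rfl

end Kernel

end Expansion

/-! ### The process u ⊗ conj u and the covariance of its centering -/

section TensorSquare

variable {V : Type} [NormedAddCommGroup V] [InnerProductSpace ℝ V] [FiniteDimensional ℝ V]
  [MeasurableSpace V] [BorelSpace V] {Ω : Type*} [MeasurableSpace Ω] {P : Measure Ω}
  [IsProbabilityMeasure P]

theorem conjSchwartz_conjSchwartz (φ : 𝓢(V, ℂ)) : conjSchwartz (conjSchwartz φ) = φ := by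
  ext x; simp [conjSchwartz_apply]

theorem exists_isTensorSquare {u : TemperedGSP V P} (hmean : IsZeroMean u)
    (hgauss : IsGaussianGSP u) (hsymm : IsSymmetricGSP u) :
    ∃ U : TemperedGSP (V × V) P, IsTensorSquare u U := by
  obtain ⟨k, n, C, hC, h⟩ := exists_norm_le_seminormSum (realCLM u)
  -- The second argument enters `productForm` through its conjugate, so the bound is needed for ψ ↦
  -- (u, conj ψ).
  obtain ⟨k', n', C', hC', h'⟩ := exists_norm_le_seminormSum
    ((realCLM u).comp (postcompCLM (E := V) (𝕜 := ℝ) (Complex.conjCLE : ℂ →L[ℝ] ℂ)))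
  obtain ⟨U, hU⟩ := exists_kernel (productForm u hgauss.memLp_four) k n k' n' (2 * (C * C'))
    (by positivity) fun φ ψ => by
      refine (norm_productForm_le hmean hgauss hsymm φ ψ).trans ?_
      have h1 : ‖u φ‖ ≤ C * seminormSum k n φ := h φ
      have h2 : ‖u (conjSchwartz ψ)‖ ≤ C' * seminormSum k' n' ψ := h' ψ
      calc 2 * (‖u φ‖ * ‖u (conjSchwartz ψ)‖)
          ≤ 2 * ((C * seminormSum k n φ) * (C' * seminormSum k' n' ψ)) := by gcongr
        _ = _ := by ring
  refine ⟨U, fun φ ψ => ?_⟩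
  rw [hU]
  refine (productForm_apply u hgauss.memLp_four φ (conjSchwartz ψ)).trans ?_
  rw [conjSchwartz_conjSchwartz]

theorem eq_of_eq_on_tensor {H : Type*} [NormedAddCommGroup H] [NormedSpace ℂ H] [NormedSpace ℝ H]
    [IsScalarTower ℝ ℂ H] [CompleteSpace H] {S T : 𝓢(V × V, ℂ) →L⋆[ℂ] H}
    (h : ∀ φ ψ, S (tensor φ (conjSchwartz ψ)) = T (tensor φ (conjSchwartz ψ))) : S = T := by
  ext1 Φ
  refine sub_eq_zero.1 (eq_zero_of_map_tensor (realCLM S - realCLM T) (fun φ ψ => ?_) Φ)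
  have := h φ (conjSchwartz ψ)
  rw [conjSchwartz_conjSchwartz] at this
  exact sub_eq_zero.2 this

theorem IsTensorSquare.unique {u : TemperedGSP V P} {U U' : TemperedGSP (V × V) P}
    (hU : IsTensorSquare u U) (hU' : IsTensorSquare u U') : U = U' :=
  eq_of_eq_on_tensor fun φ ψ => Lp.ext ((hU φ ψ).trans (hU' φ ψ).symm)

/-- The stationarity of the covariance extends from test functions to Schwartz functions. -/
theorem inner_translation {u : TemperedGSP V P}
    (h : ∀ φ ψ : 𝓢(V, ℂ), HasCompactSupport φ → HasCompactSupport ψ → ∀ a : V,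
      ∫ ω, u (translation a φ) ω * conj (u (translation a ψ) ω) ∂P =
        ∫ ω, u φ ω * conj (u ψ ω) ∂P) (a : V) (φ ψ : 𝓢(V, ℂ)) :
    inner ℂ (u (translation a ψ)) (u (translation a φ)) = inner ℂ (u ψ) (u φ) := by
  -- The defect of invariance is continuous and conjugate linear in φ. Hermitian symmetry exchanges
  -- its arguments, so the density of compactly supported functions can be used first for φ and then
  -- for ψ.
  let D (ψ : 𝓢(V, ℂ)) : 𝓢(V, ℂ) →L⋆[ℂ] ℂ :=
    (innerSL ℂ (u (translation a ψ))).comp (u.comp (translation a)) - (innerSL ℂ (u ψ)).comp u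
  have hD (φ ψ : 𝓢(V, ℂ)) : D ψ φ =
      inner ℂ (u (translation a ψ)) (u (translation a φ)) - inner ℂ (u ψ) (u φ) := rfl
  have hconj (φ ψ : 𝓢(V, ℂ)) : D φ ψ = conj (D ψ φ) := by
    rw [hD, hD, map_sub, inner_conj_symm, inner_conj_symm]
  have h0 (φ ψ : 𝓢(V, ℂ)) (hφ : HasCompactSupport φ) (hψ : HasCompactSupport ψ) :
      D ψ φ = 0 := by
    rw [hD, ← integral_mul_conj_eq_inner, ← integral_mul_conj_eq_inner, h φ ψ hφ hψ a, sub_self]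
  have h1 (ψ : 𝓢(V, ℂ)) (hψ : HasCompactSupport ψ) (φ : 𝓢(V, ℂ)) : D ψ φ = 0 :=
    eq_zero_of_map_hasCompactSupport (realCLM (D ψ)) (fun φ hφ => h0 φ ψ hφ hψ) φ
  have h2 : D ψ φ = 0 := by
    rw [hconj ψ φ]
    have : D φ ψ = 0 := eq_zero_of_map_hasCompactSupport (realCLM (D φ))
      (fun ψ hψ => by rw [realCLM_apply, hconj, h1 ψ hψ φ, map_zero]) ψ
    rw [this, map_zero]
  exact sub_eq_zero.1 h2

theorem inner_centeredGSP {E : Type} [NormedAddCommGroup E] [NormedSpace ℝ E]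
    (U : TemperedGSP E P) (Φ Ψ : 𝓢(E, ℂ)) :
    inner ℂ (centeredGSP U Ψ) (centeredGSP U Φ) =
      inner ℂ (U Ψ) (U Φ) - (∫ ω, U Φ ω ∂P) * conj (∫ ω, U Ψ ω ∂P) := by
  have hi (Φ : 𝓢(E, ℂ)) : Integrable (U Φ) P := (Lp.memLp (U Φ)).integrable (by norm_num)
  have hm : Integrable (fun ω => U Φ ω * conj (U Ψ ω)) P :=
    (Lp.memLp (U Φ)).integrable_mul (memLp_conj (Lp.memLp (U Ψ)))
  set m := ∫ ω, U Φ ω ∂P with hmdef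
  set m' := ∫ ω, U Ψ ω ∂P with hmdef'
  have hic : Integrable (fun ω => conj (U Ψ ω)) P :=
    (memLp_conj (Lp.memLp (U Ψ))).integrable (by norm_num)
  rw [← integral_mul_conj_eq_inner, ← integral_mul_conj_eq_inner]
  have e : ∫ ω, centeredGSP U Φ ω * conj (centeredGSP U Ψ ω) ∂P =
      ∫ ω, (U Φ ω * conj (U Ψ ω) - conj m' * U Φ ω) - (m * conj (U Ψ ω) - m * conj m') ∂P := by
    refine integral_congr_ae ?_
    filter_upwards [centeredGSP_apply U Φ, centeredGSP_apply U Ψ] with ω h1 h2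
    rw [h1, h2, map_sub]; ring
  have i1 : Integrable (fun ω => U Φ ω * conj (U Ψ ω) - conj m' * U Φ ω) P :=
    hm.sub ((hi Φ).const_mul _)
  have i2 : Integrable (fun ω => m * conj (U Ψ ω) - m * conj m') P :=
    (hic.const_mul _).sub (integrable_const _)
  rw [e, integral_sub i1 i2, integral_sub hm ((hi Φ).const_mul _),
    integral_sub (hic.const_mul _) (integrable_const _), integral_const_mul, integral_const_mul,
    integral_conj, ← hmdef, ← hmdef', integral_const]
  simp
  ring

/-- Subtracting the product of means cancels one of the two pairings left by symmetry. In the other,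
φ meets only φ' and ψ meets only ψ', so the two variables separate. -/
theorem inner_centeredGSP_tensor {u : TemperedGSP V P} (hmean : IsZeroMean u)
    (hgauss : IsGaussianGSP u) (hsymm : IsSymmetricGSP u) {U : TemperedGSP (V × V) P}
    (hU : IsTensorSquare u U) (φ ψ φ' ψ' : 𝓢(V, ℂ)) :
    inner ℂ (centeredGSP U (tensor φ' (conjSchwartz ψ')))
        (centeredGSP U (tensor φ (conjSchwartz ψ))) =
      inner ℂ (u φ') (u φ) * inner ℂ (u ψ) (u ψ') := by
  rw [inner_centeredGSP, integral_congr_ae (hU φ ψ), integral_congr_ae (hU φ' ψ'),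
    ← integral_mul_conj_eq_inner, ← integral_mul_conj_eq_inner, ← integral_mul_conj_eq_inner]
  have e : ∫ ω, U (tensor φ (conjSchwartz ψ)) ω * conj (U (tensor φ' (conjSchwartz ψ')) ω) ∂P =
      ∫ ω, u φ ω * conj (u ψ ω) * conj (u φ' ω * conj (u ψ' ω)) ∂P := by
    refine integral_congr_ae ?_
    filter_upwards [hU φ ψ, hU φ' ψ'] with ω h1 h2
    rw [h1, h2]
  rw [e, integral_mul_conj_mul_conj hmean hgauss hsymm]
  ring

theorem translation_tensor (a b : V) (φ ψ : 𝓢(V, ℂ)) :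
    translation (a, b) (tensor φ (conjSchwartz ψ)) =
      tensor (translation a φ) (conjSchwartz (translation b ψ)) := rfl

/-- The covariance of the centered tensor square of a stationary process is invariant under
independent translations in the two variables. -/
theorem inner_centeredGSP_translation {u : TemperedGSP V P} (hmean : IsZeroMean u)
    (hgauss : IsGaussianGSP u) (hsymm : IsSymmetricGSP u)
    (hstat : ∀ φ ψ : 𝓢(V, ℂ), HasCompactSupport φ → HasCompactSupport ψ → ∀ a : V,
      ∫ ω, u (translation a φ) ω * conj (u (translation a ψ) ω) ∂P =
        ∫ ω, u φ ω * conj (u ψ ω) ∂P)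
    {U : TemperedGSP (V × V) P} (hU : IsTensorSquare u U) (c : V × V) (Φ Ψ : 𝓢(V × V, ℂ)) :
    inner ℂ (centeredGSP U (translation c Ψ)) (centeredGSP U (translation c Φ)) =
      inner ℂ (centeredGSP U Ψ) (centeredGSP U Φ) := by
  obtain ⟨a, b⟩ := c
  -- `A` is the translated covariance and `B` the original one. They are compared on tensors in both
  -- arguments and extended by density in one argument at a time, with Hermitian symmetry exchanging
  -- the two.
  let A (Ψ : 𝓢(V × V, ℂ)) : 𝓢(V × V, ℂ) →L⋆[ℂ] ℂ :=
    (innerSL ℂ (centeredGSP U (translation (a, b) Ψ))).comp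
      ((centeredGSP U).comp (translation (a, b)))
  let B (Ψ : 𝓢(V × V, ℂ)) : 𝓢(V × V, ℂ) →L⋆[ℂ] ℂ :=
    (innerSL ℂ (centeredGSP U Ψ)).comp (centeredGSP U)
  have hA (Φ Ψ : 𝓢(V × V, ℂ)) : A Ψ Φ = conj (A Φ Ψ) :=
    (inner_conj_symm (𝕜 := ℂ) (centeredGSP U (translation (a, b) Ψ))
      (centeredGSP U (translation (a, b) Φ))).symm
  have hB (Φ Ψ : 𝓢(V × V, ℂ)) : B Ψ Φ = conj (B Φ Ψ) :=
    (inner_conj_symm (𝕜 := ℂ) (centeredGSP U Ψ) (centeredGSP U Φ)).symm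
  have h0 (φ' ψ' : 𝓢(V, ℂ)) :
      A (tensor φ' (conjSchwartz ψ')) = B (tensor φ' (conjSchwartz ψ')) := by
    refine eq_of_eq_on_tensor fun φ ψ => ?_
    change inner ℂ (centeredGSP U (translation (a, b) (tensor φ' (conjSchwartz ψ'))))
      (centeredGSP U (translation (a, b) (tensor φ (conjSchwartz ψ)))) =
      inner ℂ (centeredGSP U (tensor φ' (conjSchwartz ψ')))
        (centeredGSP U (tensor φ (conjSchwartz ψ)))
    -- One factor involves only the shift a and the other only b, so stationarity applies to each
    -- separately.
    rw [translation_tensor, translation_tensor, inner_centeredGSP_tensor hmean hgauss hsymm hU,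
      inner_centeredGSP_tensor hmean hgauss hsymm hU, inner_translation hstat,
      inner_translation hstat]
  have h1 : A Φ = B Φ := by
    refine eq_of_eq_on_tensor fun φ ψ => ?_
    rw [hA, h0, ← hB]
  have h2 : A Ψ Φ = B Ψ Φ := by rw [hA, h1, ← hB]
  exact h2

end TensorSquare

/-! ### Time-frequency shifts as translations, and the commutation relation -/

section Wigner

variable {d : ℕ} {Ω : Type*} [MeasurableSpace Ω] {P : Measure Ω} [IsProbabilityMeasure P]

/-- Translation in position and modulation in frequency become a translation after the partial
Fourier transform and the change of variables `κ`. -/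
theorem comp_kappa_partialFourierInv_translation (x ξ : EuclideanSpace ℝ (Fin d))
    (Φ : 𝓢(PhaseSpace d, ℂ)) :
    compCLMOfContinuousLinearEquiv ℂ (kappa d).symm
        (partialFourierInv (translation (x, 0) (modulation (0, ξ) Φ))) =
      translation (kappa d (x, -ξ))
        (compCLMOfContinuousLinearEquiv ℂ (kappa d).symm (partialFourierInv Φ)) := by
  -- At z = (x', y) the phases exp(i⟨y, η⟩) and exp(i⟨η, ξ⟩) combine to exp(i⟨y + ξ, η⟩), which
  -- shifts the second variable by -ξ.
  have h (z : PhaseSpace d) : partialFourierInv (translation (x, 0) (modulation (0, ξ) Φ)) z =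
      partialFourierInv Φ (z - (x, -ξ)) := by
    rw [partialFourierInv_apply, partialFourierInv_apply]
    congr 1
    refine integral_congr_ae (.of_forall fun η => ?_)
    simp only [translation_apply, modulation_apply, Prod.mk_sub_mk, sub_zero, inner_zero_right,
      zero_add, Prod.fst_sub, Prod.snd_sub, sub_neg_eq_add, inner_add_left]
    rw [← mul_assoc, ← Complex.exp_add, ← mul_add, ← Complex.ofReal_add, real_inner_comm η ξ]
  ext z
  rw [translation_apply, compCLMOfContinuousLinearEquiv_apply,
    compCLMOfContinuousLinearEquiv_apply, Function.comp_apply, Function.comp_apply, h,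
    (kappa d).symm.map_sub, ContinuousLinearEquiv.symm_apply_apply]

/-- The inner operator is the one through which the shift acts on distributions by duality. As it is
a right inverse of the shift, commutation reduces to invariance of the covariance. -/
theorem translation_modulation_inverse (x ξ : EuclideanSpace ℝ (Fin d)) (Φ : 𝓢(PhaseSpace d, ℂ)) :
    translation (x, 0) (modulation (0, ξ) (modulation (-(0, ξ)) (translation (-(x, 0)) Φ))) =
      Φ := by
  ext z
  rw [translation_apply, modulation_apply, modulation_apply, translation_apply, ← mul_assoc,
    ← Complex.exp_add, ← mul_add, ← Complex.ofReal_add, sub_neg_eq_add, sub_add_cancel]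
  simp

end Wigner

end StochasticWigner

theorem corollary6p3 (d : ℕ) {Ω : Type*} [MeasurableSpace Ω] (P : Measure Ω)
    [IsProbabilityMeasure P] (u : TemperedGSP (EuclideanSpace ℝ (Fin d)) P)
    (hmean : IsZeroMean u) (hgauss : IsGaussianGSP u) (hsymm : IsSymmetricGSP u)
    (hstat : IsStationaryGSP u) :
    (∃! U : TemperedGSP (PhaseSpace d) P, IsTensorSquare u U) ∧
    ∀ U : TemperedGSP (PhaseSpace d) P, IsTensorSquare u U →
      ∀ (x ξ : EuclideanSpace ℝ (Fin d)) (Φ : 𝓢(PhaseSpace d, ℂ)),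
        gspCovariance (zeroMeanWigner U) (translation (x, 0) (modulation (0, ξ) Φ)) =
          translationDist (x, 0) (modulationDist (0, ξ) (gspCovariance (zeroMeanWigner U) Φ)) := by
  refine ⟨?_, fun U hU x ξ Φ => ?_⟩
  · obtain ⟨U, hU⟩ := exists_isTensorSquare hmean hgauss hsymm
    exact ⟨U, hU, fun U' hU' => hU'.unique hU⟩
  · ext1 Ψ
    set Ψ' := modulation (-(0, ξ)) (translation (-(x, 0)) Ψ) with hΨ'
    change inner ℂ (zeroMeanWigner U (translation (x, 0) (modulation (0, ξ) Φ)))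
      (zeroMeanWigner U Ψ) = inner ℂ (zeroMeanWigner U Φ) (zeroMeanWigner U Ψ')
    -- With Ψ written as the shift of `Ψ'`, both arguments on the left are shifted and the claim is
    -- invariance of the covariance.
    rw [← translation_modulation_inverse x ξ Ψ, ← hΨ']
    have e (Φ : 𝓢(PhaseSpace d, ℂ)) : zeroMeanWigner U Φ = centeredGSP U
      (compCLMOfContinuousLinearEquiv ℂ (kappa d).symm (partialFourierInv Φ)) := rfl
    rw [e, e, e, e, comp_kappa_partialFourierInv_translation,
      comp_kappa_partialFourierInv_translation]
    exact inner_centeredGSP_translation hmean hgauss hsymm hstat.2 hU _ _ _
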